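/- Let $d\ge 1$ be an integer and let $B(x,r)$ denote the closed ball of $\mathbb{R}^d$ with centre $x$ and radius $r$. **Definitions.** - A Borel measure $\mu$ on $\mathbb{R}^d$ has *$n$-growth* if there is a constant $c_\mu<\infty$ with $\mu(B(x,r))\le c_\mu r^n$ for all $x\in\mathbb{R}^d$ and $r>0$. - A set $E\subset\mathbb{R}^d$ is *$n$-AD regular* if there is $c\in(0,\infty)$ with $c^{-1}r^n\le \mathcal{H}^n(E\cap B(x,r))\le c\,r^n$ for all $x\in E$ and all $0<r<\infty$ with $r\le \operatorname{diam}(E)\in[0,\infty]$. - A function $k:\{(x,y)\in\mathbb{R}^d\times\mathbb{R}^d: x\ne y\}\to\mathbb{C}$ is an *$n$-dimensional Calderón–Zygmund kernel* if there are $c>0$ and $0<\eta\le 1$ such that for all $x\neq y$, $$|k(x,y)|\le \frac{c}{|x-y|^n},$$ and $$|k(x,y)-k(x',y)|+|k(y,x)-k(y,x')|\le \frac{c\,|x-x'|^\eta}{|x-y|^{n+\eta}}\quad\text{whenever } |x-x'|\le |x-y|/2.$$ - For $\varepsilon>0$ and a finite complex Borel measure $\nu$ on $\mathbb{R}^d$,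 put $T^k_\varepsilon\nu(x)=\int_{|x-y|>\varepsilon}k(x,y)\,d\nu(y)$ for $x\in\mathbb{R}^d$. For a positive measure $\sigma$ and a function $f$, put $T^k_{\sigma,\varepsilon}f(x)=\int_{|x-y|>\varepsilon}k(x,y)f(y)\,d\sigma(y)$. - For a closed set $S\subset\mathbb{R}^d$, $M(S)$ is the space of finite complex Borel measures $\nu$ on $\mathbb{R}^d$ with $|\nu|(\mathbb{R}^d\setminus S)=0$, with norm $\|\nu\|=|\nu|(S)$ (total variation). **Theorem.** Let $U\subset\mathbb{R}^d$ be a domain (non-empty, open and connected) whose boundary $\Gamma=\partial U$ is $(d-1)$-AD regular, and let $\sigma=\mathcal{H}^{d-1}\lfloor_\Gamma$. Let $\mu$ be a Borel measure on $\mathbb{R}^d$ with $(d-1)$-growth such that $\mu(\mathbb{R}^d\setminus\overline U)=0$. Let $k$ be a $(d-1)$-dimensional Calderón–Zygmund kernel such that $T^k_\sigma$ is bounded from $L^2(\sigma)$ to $L^2(\mu)$, that is, for some constant $C$, $$\|T^k_{\sigma,\varepsilon}f\|_{L^2(\mu)}\le C\,\|f\|_{L^2(\sigma)}\qquad\text{for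 all } f\in L^2(\sigma)\text{ and all }\varepsilon>0.$$ Then $T^k$ is bounded from $M(\mathbb{R}^d\setminus U)$ to $L^{1,\infty}(\mu)$: there is a constant $c$ such that for all $\nu\in M(\mathbb{R}^d\setminus U)$, all $\lambda>0$ and all $\varepsilon>0$, $$\mu\bigl(\{x\in\mathbb{R}^d:\ |T^k_\varepsilon\nu(x)|>\lambda\}\bigr)\le \frac{c}{\lambda}\,\|\nu\|.$$ -/

import Mathlib

open MeasureTheory Set
open scoped ENNReal NNReal

noncomputable section

namespace CZ

/-- Euclidean space `ℝ^d`. -/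
abbrev Rd (d : ℕ) : Type := EuclideanSpace ℝ (Fin d)

/-- `n`-growth: `μ(B(x,r)) ≤ c r^n` for all centres `x` and radii `r > 0`. In particular such a
Borel measure is finite on bounded sets, hence Radon. -/
def HasGrowth {d : ℕ} (n : ℕ) (μ : Measure (Rd d)) : Prop :=
  ∃ c : ℝ, 0 < c ∧ ∀ x : Rd d, ∀ r : ℝ, 0 < r →
    μ (Metric.closedBall x r) ≤ ENNReal.ofReal (c * r ^ n)

/-- The restriction `H^n⌊E` of the `n`-dimensional Hausdorff measure to the set `E`. -/
def hausdorffOn {d : ℕ} (n : ℕ) (E : Set (Rd d)) : Measure (Rd d) :=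
  (Measure.hausdorffMeasure (n : ℝ)).restrict E

/-- `n`-Ahlfors-David regularity of a set `E`: for all `x ∈ E` and all (finite) radii
`0 < r ≤ diam E`, where `diam E` may be infinite, `c⁻¹ r^n ≤ H^n(E ∩ B(x,r)) ≤ c r^n`. -/
def IsADRegularSet {d : ℕ} (n : ℕ) (E : Set (Rd d)) : Prop :=
  ∃ c : ℝ, 0 < c ∧ ∀ x ∈ E, ∀ r : ℝ, 0 < r → ENNReal.ofReal r ≤ Metric.ediam E →
    ENNReal.ofReal (c⁻¹ * r ^ n) ≤ hausdorffOn n E (Metric.closedBall x r) ∧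
      hausdorffOn n E (Metric.closedBall x r) ≤ ENNReal.ofReal (c * r ^ n)

/-- `n`-dimensional Calderón-Zygmund kernels. Only the values of `k` off the diagonal matter. -/
def IsCZKernel {d : ℕ} (n : ℕ) (k : Rd d → Rd d → ℂ) : Prop :=
  ∃ c η : ℝ, 0 < c ∧ 0 < η ∧ η ≤ 1 ∧ ∀ x y : Rd d, x ≠ y →
    ‖k x y‖ ≤ c / ‖x - y‖ ^ n ∧
    ∀ x' : Rd d, ‖x - x'‖ ≤ ‖x - y‖ / 2 →
      ‖k x y - k x' y‖ + ‖k y x - k y x'‖ ≤ c * ‖x - x'‖ ^ η / ‖x - y‖ ^ ((n : ℝ) + η)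

/-- The truncated operator on complex measures,
`T_ε^k ν(x) = ∫_{|x-y|>ε} k(x,y) dν(y)`; the pairing is multiplication of complex numbers. -/
def truncMeas {d : ℕ} (k : Rd d → Rd d → ℂ) (ε : ℝ) (ν : ComplexMeasure (Rd d)) (x : Rd d) : ℂ :=
  ∫ᵛ y in {y | ε < ‖x - y‖}, k x y ∂[ContinuousLinearMap.mul ℝ ℂ; ν]

/-- The truncated operator on functions with respect to a positive measure `σ`,
`T_{σ,ε}^k f(x) = T_ε^k(fσ)(x) = ∫_{|x-y|>ε} k(x,y) f(y) dσ(y)`. -/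
def truncFun {d : ℕ} (k : Rd d → Rd d → ℂ) (σ : Measure (Rd d)) (ε : ℝ) (f : Rd d → ℂ)
    (x : Rd d) : ℂ :=
  ∫ y in {y | ε < ‖x - y‖}, k x y * f y ∂σ

/-- `T_σ^k` is bounded from `L^2(σ)` to `L^2(μ)`: the truncated operators are bounded, uniformly
in `ε > 0`. -/
def BoundedL2 {d : ℕ} (k : Rd d → Rd d → ℂ) (σ μ : Measure (Rd d)) : Prop :=
  ∃ C : ℝ≥0, ∀ ε : ℝ, 0 < ε → ∀ f : Rd d → ℂ, MemLp f 2 σ →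
    eLpNorm (truncFun k σ ε f) 2 μ ≤ C * eLpNorm f 2 σ

/-- `T^k` is bounded from `M(S)` to `L^{1,∞}(μ)`. The space `M(S)` consists of the complex measures
whose total variation `|ν|` vanishes off `S`, and its norm is `‖ν‖ = |ν|(S)`. The constant depends
neither on `ν`, nor on `t` (the level), nor on `ε`. -/
def BoundedWeakL1 {d : ℕ} (k : Rd d → Rd d → ℂ) (S : Set (Rd d)) (μ : Measure (Rd d)) : Prop :=
  ∃ c : ℝ≥0, ∀ ν : ComplexMeasure (Rd d), ν.variation Sᶜ = 0 → ∀ t : ℝ, 0 < t →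
    ∀ ε : ℝ, 0 < ε →
      μ {x | t < ‖truncMeas k ε ν x‖} ≤ c / ENNReal.ofReal t * ν.variation S

end CZ

end

/-! A point mass at `y` outside `U` can be replaced by normalized surface measure on a ball of
radius comparable to the distance δ from `y` to the boundary Γ, at the cost of a bounded error in
`L¹(μ)`. Far from `y` the smoothness of the kernel controls the error. Near `y` both terms are
controlled separately: since `μ` lives on the closure of `U`, where points stay at distance at least
δ from `y`, the size of the kernel bounds the point mass, and the `L²` hypothesis bounds the spread
mass (`exists_smear_frontier`). If δ exceeds the diameter of Γ, then for `d ≥ 2` the set `U` lies in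
a ball of radius less than δ, and size alone suffices (`exists_lintegral_of_far`). Integrating the
errors over the measure and applying Chebyshev leaves a measure on Γ.

For a measure `m` on Γ (`exists_weak_of_support`) the same spreading gives a Calderón–Zygmund
decomposition without cubes. Each point is spread over a tenth of its stopping radius, which records
its depth in the balls with `m(B) > t r^n`. The spread measure has density `O(t)` with respect to
`σ`, so the `L²` bound applies to it. The difference is bounded in `L¹(μ)` off the union of these
balls, and a Vitali covering shows that this union has `μ`-measure `O(m(Γ)/t)`.

Complex measures reduce to four positive ones, and for `d = 1` the kernel and the measure `μ` are
bounded. -/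

namespace CZ

/-! ### Truncated kernels: measurability, size, smoothness in `L¹(μ)` -/

variable {d n : ℕ} {k : Rd d → Rd d → ℂ} {μ σ ν : Measure (Rd d)}

/-- The kernel `k` truncated to `|x - y| > ε`. -/
noncomputable def truncKernel (k : Rd d → Rd d → ℂ) (ε : ℝ) (x y : Rd d) : ℂ :=
  {y | ε < ‖x - y‖}.indicator (k x) y

/-- The truncated operator acting on a positive measure. -/
noncomputable def truncPos (k : Rd d → Rd d → ℂ) (ε : ℝ) (m : Measure (Rd d)) (x : Rd d) : ℂ :=
  ∫ y, truncKernel k ε x y ∂m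

lemma measurableSet_lt_norm_sub (ε : ℝ) (x : Rd d) : MeasurableSet {y : Rd d | ε < ‖x - y‖} :=
  (isOpen_lt continuous_const (by fun_prop)).measurableSet

lemma truncKernel_of_lt {ε : ℝ} {x y : Rd d} (h : ε < ‖x - y‖) : truncKernel k ε x y = k x y := by
  simp [truncKernel, h]

lemma truncKernel_of_le {ε : ℝ} {x y : Rd d} (h : ‖x - y‖ ≤ ε) : truncKernel k ε x y = 0 := by
  simp [truncKernel, h]

/-- The Hölder condition is applied to one variable at a time. Continuity off the diagonal yields
the joint measurability that every use of Fubini below relies on. -/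
lemma IsCZKernel.continuousOn (hk : IsCZKernel n k) :
    ContinuousOn (Function.uncurry k) {p : Rd d × Rd d | p.1 ≠ p.2} := by
  obtain ⟨c, η, hc, hη, -, H⟩ := hk
  rintro ⟨x₀, y₀⟩ (h0 : x₀ ≠ y₀)
  apply ContinuousAt.continuousWithinAt
  have hpos : 0 < ‖x₀ - y₀‖ := norm_pos_iff.2 (sub_ne_zero.2 h0)
  rw [ContinuousAt, tendsto_iff_norm_sub_tendsto_zero]
  have h1 : ContinuousAt (fun p : Rd d × Rd d => ‖x₀ - p.1‖) (x₀, y₀) := by fun_prop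
  have h2 : ContinuousAt (fun p : Rd d × Rd d => ‖x₀ - p.2‖) (x₀, y₀) := by fun_prop
  have h3 : ContinuousAt (fun p : Rd d × Rd d => ‖y₀ - p.2‖) (x₀, y₀) := by fun_prop
  have hlim : Filter.Tendsto (fun p : Rd d × Rd d =>
      c * ‖x₀ - p.1‖ ^ η / ‖x₀ - p.2‖ ^ ((n : ℝ) + η)
        + c * ‖y₀ - p.2‖ ^ η / ‖y₀ - x₀‖ ^ ((n : ℝ) + η)) (nhds (x₀, y₀)) (nhds 0) := by
    have : ContinuousAt (fun p : Rd d × Rd d =>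
      c * ‖x₀ - p.1‖ ^ η / ‖x₀ - p.2‖ ^ ((n : ℝ) + η)
        + c * ‖y₀ - p.2‖ ^ η / ‖y₀ - x₀‖ ^ ((n : ℝ) + η)) (x₀, y₀) := by
      refine ContinuousAt.add (ContinuousAt.div ?_ ?_ ?_) (ContinuousAt.div_const ?_ _)
      · exact continuousAt_const.mul (h1.rpow_const (Or.inr hη.le))
      · exact h2.rpow_const (Or.inl hpos.ne')
      · exact (Real.rpow_pos_of_pos hpos _).ne'
      · exact continuousAt_const.mul (h3.rpow_const (Or.inr hη.le))
    simpa [ContinuousAt, Real.zero_rpow hη.ne'] using this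
  refine squeeze_zero' (Filter.Eventually.of_forall fun _ => norm_nonneg _) ?_ hlim
  have e1 : ∀ᶠ p : Rd d × Rd d in nhds (x₀, y₀), ‖x₀ - p.1‖ < ‖x₀ - p.2‖ / 2 :=
    h1.eventually_lt (h2.div_const 2) (by simpa using hpos)
  have e2 : ∀ᶠ p : Rd d × Rd d in nhds (x₀, y₀), ‖y₀ - p.2‖ < ‖y₀ - x₀‖ / 2 :=
    h3.eventually_lt continuousAt_const (by simpa [norm_sub_rev y₀ x₀] using hpos)
  filter_upwards [e1, e2] with p hp1 hp2
  have hne : x₀ ≠ p.2 := by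
    rintro rfl
    simp only [sub_self, norm_zero, zero_div] at hp1
    exact absurd hp1 (not_lt.2 (norm_nonneg _))
  have A := (H x₀ p.2 hne).2 p.1 hp1.le
  have B := (H y₀ x₀ h0.symm).2 p.2 hp2.le
  have A' : ‖k p.1 p.2 - k x₀ p.2‖ ≤ _ :=
    (norm_sub_rev _ _).trans_le ((le_add_of_nonneg_right (norm_nonneg _)).trans A)
  have B' : ‖k x₀ p.2 - k x₀ y₀‖ ≤ _ :=
    (norm_sub_rev _ _).trans_le ((le_add_of_nonneg_left (norm_nonneg _)).trans B)
  calc ‖Function.uncurry k p - Function.uncurry k (x₀, y₀)‖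
      = ‖(k p.1 p.2 - k x₀ p.2) + (k x₀ p.2 - k x₀ y₀)‖ := by
        simp [Function.uncurry]
    _ ≤ _ := (norm_add_le _ _).trans (add_le_add A' B')

lemma IsCZKernel.measurable_truncKernel (hk : IsCZKernel n k) {ε : ℝ} (hε : 0 < ε) :
    Measurable (Function.uncurry (truncKernel k ε)) := by
  have hopen : IsOpen {p : Rd d × Rd d | ε < ‖p.1 - p.2‖} :=
    isOpen_lt continuous_const (by fun_prop)
  have : Function.uncurry (truncKernel k ε)
      = {p : Rd d × Rd d | ε < ‖p.1 - p.2‖}.indicator (Function.uncurry k) := by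
    ext p
    simp [Function.uncurry, truncKernel, indicator]
  rw [this, ← piecewise_eq_indicator]
  refine ContinuousOn.measurable_piecewise (hk.continuousOn.mono ?_) continuousOn_const
    hopen.measurableSet
  rintro p (hp : ε < ‖p.1 - p.2‖) h
  rw [h, sub_self, norm_zero] at hp
  exact hp.not_gt hε

lemma IsCZKernel.measurable_truncKernel_right (hk : IsCZKernel n k) {ε : ℝ} (hε : 0 < ε)
    (x : Rd d) : Measurable (truncKernel k ε x) :=
  (hk.measurable_truncKernel hε).of_uncurry_left

lemma IsCZKernel.measurable_truncKernel_left (hk : IsCZKernel n k) {ε : ℝ} (hε : 0 < ε)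
    (y : Rd d) : Measurable (fun x => truncKernel k ε x y) :=
  (hk.measurable_truncKernel hε).of_uncurry_right

/-- Size bound for the truncated kernel, by the distance or by the truncation level. -/
lemma IsCZKernel.exists_size (hk : IsCZKernel n k) : ∃ c : ℝ, 0 < c ∧
    ∀ ε : ℝ, ∀ x y : Rd d, ∀ s : ℝ, 0 < s → (ε < ‖x - y‖ → s ≤ ‖x - y‖) →
      ‖truncKernel k ε x y‖ ≤ c / s ^ n := by
  obtain ⟨c, η, hc, hη, -, H⟩ := hk
  refine ⟨c, hc, fun ε x y s hs h => ?_⟩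
  rcases le_or_gt ‖x - y‖ ε with h' | h'
  · rw [truncKernel_of_le h', norm_zero]
    positivity
  · have h2 := h h'
    rw [truncKernel_of_lt h']
    have hne : x ≠ y := fun e => by simp [e] at h2; linarith
    refine ((H x y hne).1).trans ?_
    gcongr

lemma IsCZKernel.integrable_truncKernel (hk : IsCZKernel n k) {ε : ℝ} (hε : 0 < ε) (x : Rd d)
    (m : Measure (Rd d)) [IsFiniteMeasure m] : Integrable (truncKernel k ε x) m := by
  obtain ⟨c, -, hc⟩ := hk.exists_size
  exact Integrable.of_bound (hk.measurable_truncKernel_right hε x).aestronglyMeasurable (c / ε ^ n)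
    (Filter.Eventually.of_forall fun y => hc ε x y ε hε le_of_lt)

lemma IsCZKernel.measurable_truncPos (hk : IsCZKernel n k) {ε : ℝ} (hε : 0 < ε)
    (m : Measure (Rd d)) [SFinite m] : Measurable (truncPos k ε m) :=
  ((hk.measurable_truncKernel hε).stronglyMeasurable.integral_prod_right).measurable

lemma HasGrowth.measure_closedBall_lt_top (hμ : HasGrowth n μ) (x : Rd d) (r : ℝ) :
    μ (Metric.closedBall x r) < ∞ := by
  obtain ⟨c, -, h⟩ := hμ
  refine (measure_mono (Metric.closedBall_subset_closedBall (le_max_left r 1))).trans_lt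
    ((h x (max r 1) (by positivity)).trans_lt ENNReal.ofReal_lt_top)

lemma sigmaFinite_of_closedBall (h : ∀ x : Rd d, ∀ r : ℝ, μ (Metric.closedBall x r) < ∞) :
    SigmaFinite μ := by
  have : IsLocallyFiniteMeasure μ :=
    ⟨fun x => ⟨Metric.closedBall x 1, Metric.closedBall_mem_nhds x one_pos, h x 1⟩⟩
  infer_instance

/-- Tail integrals against a measure of `n`-growth. -/
lemma HasGrowth.exists_tail (hμ : HasGrowth n μ) {η : ℝ} (hη : 0 < η) :
    ∃ A : ℝ≥0, ∀ y : Rd d, ∀ R : ℝ, 0 < R →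
      ∫⁻ x in {x | R ≤ ‖x - y‖}, ENNReal.ofReal (R ^ η / ‖x - y‖ ^ ((n : ℝ) + η)) ∂μ ≤ A := by
  obtain ⟨c, hc, hμ⟩ := hμ
  set q : ℝ := (2 : ℝ) ^ (-η) with hq
  have hq0 : 0 < q := by positivity
  have hq1 : q < 1 := Real.rpow_lt_one_of_one_lt_of_neg one_lt_two (by linarith)
  have hsum : Summable fun j : ℕ => c * 2 ^ n * q ^ j :=
    (summable_geometric_of_lt_one hq0.le hq1).mul_left _
  refine ⟨(∑' j : ℕ, c * 2 ^ n * q ^ j).toNNReal, fun y R hR => ?_⟩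
  -- On the annulus between `2^j R` and `2^(j+1) R` the integrand is taken at the inner radius and
  -- `μ` at the outer one. The `n`-th powers cancel up to `2^n`, leaving the geometric term
  -- `2^(-ηj)`.
  have key : ∀ j : ℕ, R ^ η / (2 ^ j * R) ^ ((n : ℝ) + η) * (c * (2 ^ (j + 1) * R) ^ n)
      = c * 2 ^ n * q ^ j := by
    intro j
    have e1 : (2 ^ j * R : ℝ) ^ ((n : ℝ) + η) = (2 ^ j * R) ^ n * ((q ^ j)⁻¹ * R ^ η) := by
      rw [Real.rpow_add (by positivity), Real.rpow_natCast,
        Real.mul_rpow (by positivity) hR.le, hq, Real.rpow_neg (by norm_num), inv_pow, inv_inv,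
        Real.rpow_pow_comm (by norm_num)]
    have hR' : 0 < R ^ η := by positivity
    rw [e1, pow_succ, mul_pow, mul_pow, mul_pow]
    field_simp
  calc ∫⁻ x in {x | R ≤ ‖x - y‖}, ENNReal.ofReal (R ^ η / ‖x - y‖ ^ ((n : ℝ) + η)) ∂μ
      ≤ ∫⁻ x, ∑' j : ℕ, (Metric.closedBall y (2 ^ (j + 1) * R)).indicator
          (fun _ => ENNReal.ofReal (R ^ η / (2 ^ j * R) ^ ((n : ℝ) + η))) x ∂μ := by
        rw [← lintegral_indicator
          (isClosed_le continuous_const (by fun_prop : Continuous fun x : Rd d => ‖x - y‖)).measurableSet]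
        refine lintegral_mono fun x => ?_
        rw [indicator_apply]
        split_ifs with hx
        · have hx' : 1 ≤ ‖x - y‖ / R := (one_le_div hR).2 hx
          obtain ⟨j, hj1, hj2⟩ := exists_nat_pow_near hx' one_lt_two
          rw [le_div_iff₀ hR] at hj1
          rw [div_lt_iff₀ hR] at hj2
          refine le_trans ?_ (ENNReal.le_tsum j)
          rw [indicator_of_mem (by simpa [dist_eq_norm] using hj2.le)]
          gcongr
        · exact zero_le
    _ = ∑' j : ℕ, ∫⁻ x, (Metric.closedBall y (2 ^ (j + 1) * R)).indicator
          (fun _ => ENNReal.ofReal (R ^ η / (2 ^ j * R) ^ ((n : ℝ) + η))) x ∂μ :=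
        lintegral_tsum fun j =>
          (measurable_const.indicator Metric.isClosed_closedBall.measurableSet).aemeasurable
    _ ≤ ∑' j : ℕ, ENNReal.ofReal (c * 2 ^ n * q ^ j) := by
        refine ENNReal.tsum_le_tsum fun j => ?_
        rw [lintegral_indicator Metric.isClosed_closedBall.measurableSet, setLIntegral_const,
          ← key j, ENNReal.ofReal_mul (by positivity)]
        gcongr
        exact hμ y _ (by positivity)
    _ = _ := (ENNReal.ofReal_tsum_of_nonneg (fun j => by positivity) hsum).symm

/-- The `L¹(μ)` smoothness of the truncated kernels away from the poles. -/
lemma IsCZKernel.exists_far (hk : IsCZKernel n k) (hμ : HasGrowth n μ) :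
    ∃ A : ℝ≥0, ∀ ε R : ℝ, 0 < ε → 0 < R → ∀ y z : Rd d, ‖y - z‖ ≤ R →
      ∫⁻ x in {x | 2 * R ≤ ‖x - y‖}, ‖truncKernel k ε x y - truncKernel k ε x z‖ₑ ∂μ ≤ A := by
  obtain ⟨c₀, hc₀, hsize⟩ := hk.exists_size
  obtain ⟨c, η, hc, hη, -, H⟩ := hk
  obtain ⟨A, hA⟩ := hμ.exists_tail hη
  obtain ⟨c', hc', hμ⟩ := hμ
  refine ⟨c.toNNReal * A + (c₀ * (c' * 2 ^ n)).toNNReal, fun ε R hε hR y z hyz => ?_⟩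
  have hms : MeasurableSet {x : Rd d | 2 * R ≤ ‖x - y‖} :=
    (isClosed_le continuous_const (by fun_prop)).measurableSet
  -- If the truncation cuts off one of the two kernels, then `|x - y| ≤ 2ε`, because `‖y - z‖ ≤ R ≤
  -- |x - y|/2`. There the size bound at level `ε` is integrable with a constant independent of `ε`.
  have hpt : ∀ x ∈ {x : Rd d | 2 * R ≤ ‖x - y‖},
      ‖truncKernel k ε x y - truncKernel k ε x z‖ₑ
        ≤ ENNReal.ofReal c * ENNReal.ofReal (R ^ η / ‖x - y‖ ^ ((n : ℝ) + η))
          + (Metric.closedBall y (2 * ε)).indicator (fun _ => ENNReal.ofReal (c₀ / ε ^ n)) x := by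
    rintro x (hx : 2 * R ≤ ‖x - y‖)
    have t1 : ‖x - y‖ ≤ ‖x - z‖ + ‖y - z‖ := by
      simpa [norm_sub_rev z y] using norm_sub_le_norm_sub_add_norm_sub x z y
    have t2 : ‖x - z‖ ≤ ‖x - y‖ + ‖y - z‖ := norm_sub_le_norm_sub_add_norm_sub x y z
    have hsz : ∀ w : Rd d, ‖truncKernel k ε x w‖ₑ ≤ ENNReal.ofReal (c₀ / ε ^ n) := fun w => by
      rw [← ofReal_norm]
      exact ENNReal.ofReal_le_ofReal (hsize ε x w ε hε le_of_lt)
    rcases le_or_gt ‖x - y‖ ε with h1 | h1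
    · rw [truncKernel_of_le h1, zero_sub, enorm_neg, indicator_of_mem
        (by simp [dist_eq_norm]; linarith)]
      exact (hsz z).trans le_add_self
    rcases le_or_gt ‖x - z‖ ε with h2 | h2
    · rw [truncKernel_of_le h2, sub_zero, indicator_of_mem
        (by simp [dist_eq_norm]; linarith)]
      exact (hsz y).trans le_add_self
    · rw [truncKernel_of_lt h1, truncKernel_of_lt h2, ← ENNReal.ofReal_mul hc.le, ← ofReal_norm]
      refine le_trans (ENNReal.ofReal_le_ofReal ?_) le_self_add
      have hne : y ≠ x := fun e => by simp [e] at h1; linarith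
      have := (H y x hne).2 z (by rw [norm_sub_rev y x]; linarith)
      rw [norm_sub_rev y x] at this
      refine ((le_add_of_nonneg_left (norm_nonneg _)).trans this).trans ?_
      rw [mul_div_assoc]
      gcongr
  calc ∫⁻ x in {x | 2 * R ≤ ‖x - y‖}, ‖truncKernel k ε x y - truncKernel k ε x z‖ₑ ∂μ
      ≤ ∫⁻ x in {x | 2 * R ≤ ‖x - y‖},
          (ENNReal.ofReal c * ENNReal.ofReal (R ^ η / ‖x - y‖ ^ ((n : ℝ) + η))
          + (Metric.closedBall y (2 * ε)).indicator (fun _ => ENNReal.ofReal (c₀ / ε ^ n)) x) ∂μ :=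
        setLIntegral_mono' hms hpt
    _ ≤ ENNReal.ofReal c * ∫⁻ x in {x | R ≤ ‖x - y‖},
          ENNReal.ofReal (R ^ η / ‖x - y‖ ^ ((n : ℝ) + η)) ∂μ
          + ∫⁻ x, (Metric.closedBall y (2 * ε)).indicator
              (fun _ => ENNReal.ofReal (c₀ / ε ^ n)) x ∂μ := by
        rw [lintegral_add_right _
          (measurable_const.indicator Metric.isClosed_closedBall.measurableSet),
          lintegral_const_mul' _ _ ENNReal.ofReal_ne_top]
        gcongr _ * ?_ + ?_
        · exact lintegral_mono_set fun x (hx : 2 * R ≤ _) => show R ≤ _ by linarith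
        · exact setLIntegral_le_lintegral _ _
    _ ≤ ENNReal.ofReal c * A + ENNReal.ofReal (c₀ * (c' * 2 ^ n)) := by
        gcongr
        · exact hA y R hR
        · rw [lintegral_indicator Metric.isClosed_closedBall.measurableSet, setLIntegral_const]
          calc _ ≤ ENNReal.ofReal (c₀ / ε ^ n) * ENNReal.ofReal (c' * (2 * ε) ^ n) := by
                gcongr; exact hμ y _ (by positivity)
            _ = _ := by
                rw [← ENNReal.ofReal_mul (by positivity), mul_pow]
                congr 1; field_simp
    _ = _ := by push_cast; rfl

/-! ### Integration against complex measures through the Jordan decomposition -/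

section ComplexMeasure

variable {X : Type*} [MeasurableSpace X]

/-- The complex measure `s ↦ p(s) v`. -/
noncomputable def realSmul (p : Measure X) [IsFiniteMeasure p] (v : ℂ) : ComplexMeasure X :=
  p.toSignedMeasure.mapRange ((ContinuousLinearMap.id ℝ ℝ).smulRight v).toLinearMap.toAddMonoidHom
    ((ContinuousLinearMap.id ℝ ℝ).smulRight v).continuous

lemma realSmul_apply (p : Measure X) [IsFiniteMeasure p] (v : ℂ) {s : Set X}
    (hs : MeasurableSet s) : realSmul p v s = p.real s • v := by
  simp [realSmul, hs]

lemma variation_realSmul_le (p : Measure X) [IsFiniteMeasure p] (v : ℂ) :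
    (realSmul p v).variation ≤ ‖v‖ₑ • p := by
  refine VectorMeasure.variation_le_of_forall_enorm_le fun s hs => ?_
  rw [realSmul_apply p v hs, enorm_smul, Measure.smul_apply, smul_eq_mul, mul_comm,
    Real.enorm_of_nonneg measureReal_nonneg, ofReal_measureReal]

lemma integrable_realSmul {p : Measure X} [IsFiniteMeasure p] (v : ℂ) {f : X → ℂ}
    (hf : Integrable f p) : (realSmul p v).Integrable f :=
  hf.of_measure_le_smul enorm_ne_top (variation_realSmul_le p v)

lemma integral_realSmul {p : Measure X} [IsFiniteMeasure p] (v : ℂ) {f : X → ℂ}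
    (hf : Integrable f p) :
    (realSmul p v).integral f (ContinuousLinearMap.mul ℝ ℂ) = v * ∫ x, f x ∂p := by
  have hf' : Integrable f p.toSignedMeasure.variation := by simpa using hf
  rw [← integral_const_mul, ← VectorMeasure.integral_toSignedMeasure,
    show (fun x => v * f x) = fun x => ContinuousLinearMap.mul ℝ ℂ v (f x) from rfl,
    VectorMeasure.integral_continuousLinearMap_comp hf', VectorMeasure.integral_eq_setToFun,
    VectorMeasure.integral_eq_setToFun]
  symm
  -- After `v` is absorbed into the pairing, the two integrals differ only in the reference measure
  -- of `setToFun`, and one is dominated by `‖v‖` times the other.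
  have hT : (realSmul p v).transpose (ContinuousLinearMap.mul ℝ ℂ)
      = p.toSignedMeasure.transpose ((ContinuousLinearMap.lsmul ℝ ℝ).flip ∘L
        ContinuousLinearMap.mul ℝ ℂ v) := by
    ext s hs z
    change z * (p.toSignedMeasure s • v) = p.toSignedMeasure s • (v * z)
    rw [mul_smul_comm, mul_comm]
  simp_rw [hT]
  exact setToFun_congr_measure_of_integrable ‖v‖ₑ enorm_ne_top
    (by simpa using variation_realSmul_le p v) _ _ f hf'

variable (ν : ComplexMeasure X)

lemma variation_re_le : (ComplexMeasure.re ν).variation ≤ ν.variation := by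
  refine VectorMeasure.variation_le_of_forall_enorm_le fun s _ => ?_
  refine le_trans ?_ (ν.enorm_measure_le_variation s)
  rw [← ofReal_norm, ← ofReal_norm]
  exact ENNReal.ofReal_le_ofReal (Complex.abs_re_le_norm (ν s))

lemma variation_im_le : (ComplexMeasure.im ν).variation ≤ ν.variation := by
  refine VectorMeasure.variation_le_of_forall_enorm_le fun s _ => ?_
  refine le_trans ?_ (ν.enorm_measure_le_variation s)
  rw [← ofReal_norm, ← ofReal_norm]
  exact ENNReal.ofReal_le_ofReal (Complex.abs_im_le_norm (ν s))

lemma posPart_le_variation (s : SignedMeasure X) :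
    s.toJordanDecomposition.posPart ≤ s.variation := by
  rw [← SignedMeasure.totalVariation_eq_variation]
  exact Measure.le_add_right le_rfl

lemma negPart_le_variation (s : SignedMeasure X) :
    s.toJordanDecomposition.negPart ≤ s.variation := by
  rw [← SignedMeasure.totalVariation_eq_variation]
  exact Measure.le_add_left le_rfl

/-- Jordan decomposition of a complex measure and of the integrals against it. -/
lemma exists_jordan : ∃ p : Fin 4 → Measure X, (∀ i, IsFiniteMeasure (p i)) ∧
    (∀ i, p i ≤ ν.variation) ∧ ∀ f : X → ℂ, (∀ i, Integrable f (p i)) →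
      ν.integral f (ContinuousLinearMap.mul ℝ ℂ) =
        (∫ x, f x ∂(p 0)) - (∫ x, f x ∂(p 1))
          + Complex.I * ((∫ x, f x ∂(p 2)) - (∫ x, f x ∂(p 3))) := by
  set a := (ComplexMeasure.re ν).toJordanDecomposition with ha
  set b := (ComplexMeasure.im ν).toJordanDecomposition with hb
  refine ⟨![a.posPart, a.negPart, b.posPart, b.negPart], ?_, ?_, ?_⟩
  · intro i
    fin_cases i <;> simp <;> infer_instance
  · intro i
    fin_cases i
    · exact (posPart_le_variation _).trans (variation_re_le ν)
    · exact (negPart_le_variation _).trans (variation_re_le ν)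
    · exact (posPart_le_variation _).trans (variation_im_le ν)
    · exact (negPart_le_variation _).trans (variation_im_le ν)
  · intro f hf
    have h0 : Integrable f a.posPart := hf 0
    have h1 : Integrable f a.negPart := hf 1
    have h2 : Integrable f b.posPart := hf 2
    have h3 : Integrable f b.negPart := hf 3
    have hν : ν = realSmul a.posPart 1 - realSmul a.negPart 1
        + (realSmul b.posPart Complex.I - realSmul b.negPart Complex.I) := by
      ext s hs
      have e1 := (ComplexMeasure.re ν).apply_eq_posPart_real_sub_negPart_real hs
      have e2 := (ComplexMeasure.im ν).apply_eq_posPart_real_sub_negPart_real hs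
      rw [← ha] at e1
      rw [← hb] at e2
      change (ν s).re = _ at e1
      change (ν s).im = _ at e2
      simp only [add_apply, sub_apply, realSmul_apply _ _ hs]
      apply Complex.ext <;> simp [e1, e2]
    have i0 := integrable_realSmul 1 h0
    have i1 := integrable_realSmul 1 h1
    have i2 := integrable_realSmul Complex.I h2
    have i3 := integrable_realSmul Complex.I h3
    conv_lhs => rw [hν]
    rw [VectorMeasure.integral_add_vectorMeasure (i0.sub_vectorMeasure i1)
      (i2.sub_vectorMeasure i3), VectorMeasure.integral_sub_vectorMeasure i0 i1,
      VectorMeasure.integral_sub_vectorMeasure i2 i3, integral_realSmul _ h0,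
      integral_realSmul _ h1, integral_realSmul _ h2, integral_realSmul _ h3]
    simp
    ring

end ComplexMeasure

/-! ### Rewriting the operator and the `L²` hypothesis in terms of measures -/

lemma truncMeas_eq (ε : ℝ) (ν : ComplexMeasure (Rd d)) (x : Rd d) :
    truncMeas k ε ν x = ν.integral (truncKernel k ε x) (ContinuousLinearMap.mul ℝ ℂ) :=
  (VectorMeasure.integral_indicator (measurableSet_lt_norm_sub ε x)).symm

lemma eLpNorm_two_sq {X E : Type*} [MeasurableSpace X] [NormedAddCommGroup E] (f : X → E)
    (m : Measure X) : eLpNorm f 2 m ^ 2 = ∫⁻ x, ‖f x‖ₑ ^ 2 ∂m := by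
  simpa using eLpNorm_nnreal_pow_eq_lintegral (f := f) (μ := m) (p := 2) two_ne_zero

/-- The `L²` bound, for measures of bounded density with respect to `σ`. -/
lemma BoundedL2.exists_sq (hT : BoundedL2 k σ μ) : ∃ C : ℝ≥0, ∀ ε : ℝ, 0 < ε →
    ∀ f : Rd d → ℝ≥0∞, Measurable f → ∀ K : ℝ≥0∞, K ≠ ∞ → (∀ z, f z ≤ K) →
      σ.withDensity f univ ≠ ∞ →
      ∫⁻ x, ‖truncPos k ε (σ.withDensity f) x‖ₑ ^ 2 ∂μ ≤ C * K * σ.withDensity f univ := by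
  obtain ⟨C, hC⟩ := hT
  refine ⟨C ^ 2, fun ε hε f hf K hK hfK hfin => ?_⟩
  have hlt : ∀ z, f z < ∞ := fun z => (hfK z).trans_lt hK.lt_top
  set g : Rd d → ℂ := fun z => ((f z).toReal : ℂ) with hg
  have hgm : Measurable g := Complex.measurable_ofReal.comp hf.ennreal_toReal
  have hgn : ∀ z, ‖g z‖ₑ = f z := fun z => by
    rw [hg, ← ofReal_norm, Complex.norm_real, Real.norm_of_nonneg ENNReal.toReal_nonneg,
      ENNReal.ofReal_toReal (hlt z).ne]
  -- Pointwise `f² ≤ K f`.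
  have hsq : eLpNorm g 2 σ ^ 2 ≤ K * σ.withDensity f univ := by
    rw [eLpNorm_two_sq, withDensity_apply _ MeasurableSet.univ, Measure.restrict_univ,
      ← lintegral_const_mul _ hf]
    refine lintegral_mono fun z => ?_
    rw [hgn, sq]
    gcongr
    exact hfK z
  have hmem : MemLp g 2 σ := by
    refine ⟨hgm.aestronglyMeasurable, ?_⟩
    by_contra h
    rw [not_lt, top_le_iff] at h
    rw [h] at hsq
    exact (ENNReal.mul_lt_top hK.lt_top hfin.lt_top).ne (top_le_iff.1 (by simpa using hsq))
  have heq : truncPos k ε (σ.withDensity f) = truncFun k σ ε g := by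
    ext x
    rw [truncPos, integral_withDensity_eq_integral_toReal_smul hf (Filter.Eventually.of_forall hlt),
      truncFun, ← integral_indicator (measurableSet_lt_norm_sub ε x)]
    congr 1
    ext y
    simp only [truncKernel, indicator_apply, hg]
    split_ifs
    · rw [Complex.real_smul, mul_comm]
    · simp
  rw [heq, ← eLpNorm_two_sq]
  calc _ ≤ (C * eLpNorm g 2 σ) ^ 2 := by gcongr; exact hC ε hε g hmem
    _ ≤ _ := by rw [mul_pow, mul_assoc]; push_cast; gcongr

open ProbabilityTheory

/-! ### Spreading point masses by a Markov kernel -/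

section Smear

/-- The density of normalized `σ` on the closed ball with centre `y` and radius `r y`. -/
noncomputable def smearDensity (σ : Measure (Rd d)) (r : Rd d → ℝ) (y z : Rd d) : ℝ≥0∞ :=
  (Metric.closedBall y (r y)).indicator (fun _ => (σ (Metric.closedBall y (r y)))⁻¹) z

/-- The centres for which the normalization in `smearDensity` makes sense. -/
def smearSet (σ : Measure (Rd d)) (r : Rd d → ℝ) : Set (Rd d) :=
  {y | σ (Metric.closedBall y (r y)) ≠ 0 ∧ σ (Metric.closedBall y (r y)) ≠ ∞}

variable {r : Rd d → ℝ}

lemma smearDensity_le (y z : Rd d) :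
    smearDensity σ r y z ≤ (σ (Metric.closedBall y (r y)))⁻¹ :=
  indicator_le_self' (fun _ _ => zero_le) z

lemma withDensity_smearDensity_apply (y : Rd d) {s : Set (Rd d)} (hs : MeasurableSet s) :
    σ.withDensity (smearDensity σ r y) s
      = (σ (Metric.closedBall y (r y)))⁻¹ * σ (Metric.closedBall y (r y) ∩ s) := by
  rw [withDensity_apply _ hs]
  simp only [smearDensity]
  rw [setLIntegral_indicator Metric.isClosed_closedBall.measurableSet, setLIntegral_const]

variable [SFinite σ]

lemma measurableSet_graph_closedBall (hr : Measurable r) :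
    MeasurableSet {p : Rd d × Rd d | p.2 ∈ Metric.closedBall p.1 (r p.1)} :=
  measurableSet_le (by fun_prop : Measurable fun p : Rd d × Rd d => dist p.2 p.1)
    (hr.comp measurable_fst)

lemma measurable_measure_closedBall (σ : Measure (Rd d)) [SFinite σ] (hr : Measurable r) :
    Measurable fun y => σ (Metric.closedBall y (r y)) :=
  measurable_measure_prodMk_left (ν := σ) (measurableSet_graph_closedBall hr)

lemma measurable_smearDensity (σ : Measure (Rd d)) [SFinite σ] (hr : Measurable r) :
    Measurable (Function.uncurry (smearDensity σ r)) := by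
  have : Function.uncurry (smearDensity σ r)
      = {p : Rd d × Rd d | p.2 ∈ Metric.closedBall p.1 (r p.1)}.indicator
        (fun p => (σ (Metric.closedBall p.1 (r p.1)))⁻¹) := by
    ext p
    simp [Function.uncurry, smearDensity, indicator]
  rw [this]
  exact ((measurable_measure_closedBall σ hr).comp measurable_fst).inv.indicator
    (measurableSet_graph_closedBall hr)

lemma measurableSet_smearSet (σ : Measure (Rd d)) [SFinite σ] (hr : Measurable r) :
    MeasurableSet (smearSet σ r) :=
  ((measurable_measure_closedBall σ hr) (measurableSet_singleton 0)).compl.inter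
    ((measurable_measure_closedBall σ hr) (measurableSet_singleton ∞)).compl

open Classical in
/-- The kernel that spreads a point mass at `y` evenly over `closedBall y (r y)`, with respect to
`σ`; point masses that cannot be spread stay where they are. -/
noncomputable def smearKernel (σ : Measure (Rd d)) [SFinite σ] (hr : Measurable r) :
    Kernel (Rd d) (Rd d) :=
  Kernel.piecewise (measurableSet_smearSet σ hr)
    (Kernel.withDensity (Kernel.const _ σ) (smearDensity σ r)) Kernel.id

lemma smearKernel_of_mem (hr : Measurable r) {y : Rd d} (hy : y ∈ smearSet σ r) :
    smearKernel σ hr y = σ.withDensity (smearDensity σ r y) := by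
  classical
  rw [smearKernel, Kernel.piecewise_apply, if_pos hy,
    Kernel.withDensity_apply _ (measurable_smearDensity σ hr), Kernel.const_apply]

lemma smearKernel_of_notMem (hr : Measurable r) {y : Rd d} (hy : y ∉ smearSet σ r) :
    smearKernel σ hr y = Measure.dirac y := by
  classical
  rw [smearKernel, Kernel.piecewise_apply, if_neg hy, Kernel.id_apply]

instance isMarkovKernel_smearKernel (hr : Measurable r) : IsMarkovKernel (smearKernel σ hr) := by
  refine ⟨fun y => ?_⟩
  by_cases hy : y ∈ smearSet σ r
  · rw [smearKernel_of_mem hr hy]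
    refine ⟨?_⟩
    rw [withDensity_smearDensity_apply y MeasurableSet.univ, inter_univ,
      ENNReal.inv_mul_cancel hy.1 hy.2]
  · rw [smearKernel_of_notMem hr hy]
    infer_instance

lemma ae_smearKernel_mem_closedBall (hr : Measurable r) {y : Rd d} (hy : 0 ≤ r y) :
    ∀ᵐ z ∂(smearKernel σ hr y), z ∈ Metric.closedBall y (r y) := by
  by_cases h : y ∈ smearSet σ r
  · rw [smearKernel_of_mem hr h, ae_iff, ← compl_def,
      withDensity_smearDensity_apply y Metric.isClosed_closedBall.measurableSet.compl]
    simp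
  · rw [smearKernel_of_notMem hr h]
    exact (ae_dirac_iff (p := fun z => z ∈ Metric.closedBall y (r y))
      Metric.isClosed_closedBall.measurableSet).2 (Metric.mem_closedBall_self hy)

/-- Tonelli. The explicit density is what gets bounded by the level before the `L²` hypothesis is
applied. -/
lemma smearKernel_comp (hr : Measurable r) [SFinite ν] (h : ∀ᵐ y ∂ν, y ∈ smearSet σ r) :
    ν.bind (smearKernel σ hr) = σ.withDensity fun z => ∫⁻ y, smearDensity σ r y z ∂ν := by
  ext s hs
  rw [Measure.bind_apply hs (Kernel.aemeasurable _), withDensity_apply _ hs,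
    lintegral_lintegral_swap (f := fun z y => smearDensity σ r y z)
      ((measurable_smearDensity σ hr).comp measurable_swap).aemeasurable]
  refine lintegral_congr_ae ?_
  filter_upwards [h] with y hy
  rw [smearKernel_of_mem hr hy, withDensity_apply _ hs]

end Smear

/-! ### The `L¹(μ)` error of spreading a measure -/

section Comp

variable {κ : Kernel (Rd d) (Rd d)} [IsMarkovKernel κ]

lemma IsCZKernel.truncPos_bind (hk : IsCZKernel n k) {ε : ℝ} (hε : 0 < ε) [IsFiniteMeasure ν]
    (x : Rd d) : truncPos k ε (ν.bind κ) x = ∫ y, truncPos k ε (κ y) x ∂ν := by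
  have hint := hk.integrable_truncKernel hε x (ν.bind κ)
  rw [Measure.comp_eq_comp_const_apply] at hint
  rw [truncPos, Measure.comp_eq_comp_const_apply, Kernel.integral_comp hint, Kernel.const_apply]
  rfl

lemma IsCZKernel.measurable_truncPos_kernel (hk : IsCZKernel n k) {ε : ℝ} (hε : 0 < ε)
    (κ : Kernel (Rd d) (Rd d)) [IsMarkovKernel κ] :
    Measurable fun p : Rd d × Rd d => truncPos k ε (κ p.2) p.1 := by
  have hg : Measurable fun q : (Rd d × Rd d) × Rd d => (q.1.1, q.2) := by fun_prop
  have h := ((hk.measurable_truncKernel hε).comp hg).stronglyMeasurable.integral_kernel_prod_right'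
    (κ := κ.comap (Prod.snd : Rd d × Rd d → Rd d) measurable_snd)
  convert h.measurable using 2 with p
  rw [Kernel.comap_apply]
  rfl

/-- Fubini and the triangle inequality reduce the error for a whole measure to that for a single
point mass. -/
lemma IsCZKernel.lintegral_truncPos_sub_bind_le (hk : IsCZKernel n k) {ε : ℝ} (hε : 0 < ε)
    [SFinite μ] [IsFiniteMeasure ν] {G : Set (Rd d)} {A : ℝ≥0∞}
    (h : ∀ᵐ y ∂ν, ∫⁻ x in G, ‖truncKernel k ε x y - truncPos k ε (κ y) x‖ₑ ∂μ ≤ A) :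
    ∫⁻ x in G, ‖truncPos k ε ν x - truncPos k ε (ν.bind κ) x‖ₑ ∂μ ≤ A * ν univ := by
  have hm := (hk.measurable_truncKernel hε).sub (hk.measurable_truncPos_kernel hε κ)
  have hint : ∀ x, Integrable (fun y => truncPos k ε (κ y) x) ν := fun x => by
    obtain ⟨c, hc, hsize⟩ := hk.exists_size
    have hx : Measurable fun y => truncPos k ε (κ y) x :=
      Measurable.of_uncurry_left (f := fun x y => truncPos k ε (κ y) x)
        (hk.measurable_truncPos_kernel hε κ)
    refine Integrable.of_bound hx.aestronglyMeasurable
      (c / ε ^ n) (Filter.Eventually.of_forall fun y => ?_)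
    refine (norm_integral_le_of_norm_le_const
      (Filter.Eventually.of_forall fun z => hsize ε x z ε hε le_of_lt)).trans ?_
    simp
  calc ∫⁻ x in G, ‖truncPos k ε ν x - truncPos k ε (ν.bind κ) x‖ₑ ∂μ
      = ∫⁻ x in G, ‖∫ y, (truncKernel k ε x y - truncPos k ε (κ y) x) ∂ν‖ₑ ∂μ := by
        refine lintegral_congr fun x => ?_
        rw [hk.truncPos_bind hε, integral_sub (hk.integrable_truncKernel hε x ν) (hint x)]
        rfl
    _ ≤ ∫⁻ x in G, ∫⁻ y, ‖truncKernel k ε x y - truncPos k ε (κ y) x‖ₑ ∂ν ∂μ :=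
        lintegral_mono fun x => enorm_integral_le_lintegral_enorm _
    _ = ∫⁻ y, ∫⁻ x in G, ‖truncKernel k ε x y - truncPos k ε (κ y) x‖ₑ ∂μ ∂ν :=
        lintegral_lintegral_swap hm.enorm.aemeasurable
    _ ≤ ∫⁻ _, A ∂ν := lintegral_mono_ae h
    _ = A * ν univ := lintegral_const _

/-- The same argument reduces one spread point mass to pairs of point masses, to which `exists_far`
applies. -/
lemma IsCZKernel.lintegral_truncKernel_sub_truncPos_le (hk : IsCZKernel n k) {ε : ℝ} (hε : 0 < ε)
    [SFinite μ] {m : Measure (Rd d)} [IsProbabilityMeasure m] {G : Set (Rd d)} {y : Rd d}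
    {A : ℝ≥0∞}
    (h : ∀ᵐ z ∂m, ∫⁻ x in G, ‖truncKernel k ε x y - truncKernel k ε x z‖ₑ ∂μ ≤ A) :
    ∫⁻ x in G, ‖truncKernel k ε x y - truncPos k ε m x‖ₑ ∂μ ≤ A := by
  have hm : Measurable fun p : Rd d × Rd d => truncKernel k ε p.1 y - truncKernel k ε p.1 p.2 :=
    ((hk.measurable_truncKernel_left hε y).comp measurable_fst).sub (hk.measurable_truncKernel hε)
  calc ∫⁻ x in G, ‖truncKernel k ε x y - truncPos k ε m x‖ₑ ∂μ
      = ∫⁻ x in G, ‖∫ z, (truncKernel k ε x y - truncKernel k ε x z) ∂m‖ₑ ∂μ := by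
        refine lintegral_congr fun x => ?_
        rw [integral_sub (integrable_const _) (hk.integrable_truncKernel hε x m)]
        simp [truncPos]
    _ ≤ ∫⁻ x in G, ∫⁻ z, ‖truncKernel k ε x y - truncKernel k ε x z‖ₑ ∂m ∂μ :=
        lintegral_mono fun x => enorm_integral_le_lintegral_enorm _
    _ = ∫⁻ z, ∫⁻ x in G, ‖truncKernel k ε x y - truncKernel k ε x z‖ₑ ∂μ ∂m :=
        lintegral_lintegral_swap hm.enorm.aemeasurable
    _ ≤ ∫⁻ _, A ∂m := lintegral_mono_ae h
    _ = A := by simp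

end Comp

/-! ### Chebyshev bounds, concentrated measures and the Vitali covering -/

lemma measure_lt_norm_le {g : Rd d → ℂ} (hg : Measurable g) {s : ℝ} (hs : 0 < s) :
    μ {x | s < ‖g x‖} ≤ (∫⁻ x, ‖g x‖ₑ ∂μ) / ENNReal.ofReal s := by
  refine le_trans (measure_mono fun x (hx : s < ‖g x‖) => ?_)
    (meas_ge_le_lintegral_div hg.enorm.aemeasurable (by simpa using hs) ENNReal.ofReal_ne_top)
  rw [mem_ofPred_eq, ← ofReal_norm]
  exact ENNReal.ofReal_le_ofReal hx.le

lemma measure_lt_norm_le_sq {g : Rd d → ℂ} (hg : Measurable g) {s : ℝ} (hs : 0 < s) :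
    μ {x | s < ‖g x‖} ≤ (∫⁻ x, ‖g x‖ₑ ^ 2 ∂μ) / ENNReal.ofReal s ^ 2 := by
  refine le_trans (measure_mono fun x (hx : s < ‖g x‖) => ?_)
    (meas_ge_le_lintegral_div (hg.enorm.pow_const 2).aemeasurable
      (pow_ne_zero _ (by simpa using hs)) (ENNReal.pow_ne_top ENNReal.ofReal_ne_top))
  rw [mem_ofPred_eq, ← ofReal_norm]
  gcongr

lemma inv_ofReal_half (t : ℝ) : (ENNReal.ofReal (t / 2))⁻¹ = 2 * (ENNReal.ofReal t)⁻¹ := by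
  rw [ENNReal.ofReal_div_of_pos two_pos, ENNReal.inv_div (by simp) (by simp), ENNReal.ofReal_ofNat,
    ENNReal.div_eq_inv_mul, mul_comm]

lemma exists_pow_eq (hn : n ≠ 0) {a : ℝ} (ha : 0 < a) : ∃ s : ℝ, 0 < s ∧ s ^ n = a :=
  ⟨a ^ (n : ℝ)⁻¹, Real.rpow_pos_of_pos ha _, Real.rpow_inv_natCast_pow ha.le hn⟩

/-- A measure of large mass relative to the size of its support: only the size of the kernel
matters. -/
lemma IsCZKernel.exists_weak_of_concentrated (hk : IsCZKernel n k) (hμ : HasGrowth n μ)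
    (hn : n ≠ 0) : ∃ c : ℝ≥0, ∀ (m : Measure (Rd d)) [IsFiniteMeasure m] (z : Rd d) (R t ε : ℝ),
      0 < R → 0 < t → 0 < ε → m (Metric.closedBall z R)ᶜ = 0 → t * R ^ n ≤ m.real univ →
      μ {x | t < ‖truncPos k ε m x‖} ≤ c / ENNReal.ofReal t * m univ := by
  obtain ⟨c, hc, hsize⟩ := hk.exists_size
  obtain ⟨c', hc', hμ⟩ := hμ
  refine ⟨(c' * (2 ^ n * (c + 1))).toNNReal, fun m _ z R t ε hR ht hε hm hM => ?_⟩
  set M := m.real univ with hMdef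
  have hM0 : 0 < M := lt_of_lt_of_le (by positivity) hM
  -- The radius `s` makes `c M / (s/2)^n = t c/(c+1) < t`, so the level set lies in the ball of
  -- radius `s`; also `s ≥ 2R`, so outside that ball the support is at distance at least `s/2`.
  obtain ⟨s, hs, hsn⟩ := exists_pow_eq hn (a := 2 ^ n * (c + 1) * M / t) (by positivity)
  have hsR : 2 * R ≤ s := by
    refine le_of_pow_le_pow_left₀ hn hs.le ?_
    rw [hsn, le_div_iff₀ ht, mul_pow]
    nlinarith [mul_le_mul_of_nonneg_left hM (by positivity : (0 : ℝ) ≤ 2 ^ n),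
      (by positivity : (0 : ℝ) < 2 ^ n * (c * M))]
  have hsub : {x | t < ‖truncPos k ε m x‖} ⊆ Metric.closedBall z s := by
    intro x (hx : t < _)
    by_contra h
    rw [Metric.mem_closedBall, not_le, dist_eq_norm] at h
    have hb : ∀ᵐ y ∂m, ‖truncKernel k ε x y‖ ≤ c / (s / 2) ^ n := by
      filter_upwards [compl_mem_ae_iff.2 hm] with y hy
      rw [compl_compl, Metric.mem_closedBall, dist_eq_norm] at hy
      refine hsize ε x y _ (by positivity) fun _ => ?_
      have := norm_sub_le_norm_sub_add_norm_sub x y z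
      linarith
    have := norm_integral_le_of_norm_le_const hb
    rw [div_pow, hsn, ← hMdef] at this
    have e : c / (2 ^ n * (c + 1) * M / t / 2 ^ n) * M = t * (c / (c + 1)) := by
      field_simp
    rw [e] at this
    have h2 : t * (c / (c + 1)) < t * 1 := by
      gcongr
      rw [div_lt_one (by positivity)]
      linarith
    rw [mul_one] at h2
    exact absurd hx (not_lt.2 (this.trans h2.le))
  calc μ {x | t < ‖truncPos k ε m x‖} ≤ ENNReal.ofReal (c' * s ^ n) :=
        (measure_mono hsub).trans (hμ z s hs)
    _ = ENNReal.ofReal (c' * (2 ^ n * (c + 1)) / t * M) := by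
        rw [hsn]; congr 1; ring
    _ = _ := by
        rw [ENNReal.ofReal_mul (by positivity), ENNReal.ofReal_div_of_pos ht, hMdef,
          ofReal_measureReal]
        rfl

/-- Vitali covering of the balls in which `m` is large. -/
lemma HasGrowth.exists_cover (hμ : HasGrowth n μ) : ∃ c : ℝ≥0,
    ∀ (m : Measure (Rd d)) (t R : ℝ), 0 < t →
      (∀ y r, 0 < r → ENNReal.ofReal (t * r ^ n) < m (Metric.closedBall y r) → r ≤ R) →
      ∃ E : Set (Rd d), MeasurableSet E ∧
        (∀ y r, 0 < r → ENNReal.ofReal (t * r ^ n) < m (Metric.closedBall y r) →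
          Metric.closedBall y r ⊆ E) ∧
        μ E ≤ c / ENNReal.ofReal t * m univ := by
  obtain ⟨c, hc, hμ⟩ := hμ
  refine ⟨(c * 5 ^ n).toNNReal, fun m t R ht hR => ?_⟩
  set B : Set (Rd d × ℝ) :=
    {p | 0 < p.2 ∧ ENNReal.ofReal (t * p.2 ^ n) < m (Metric.closedBall p.1 p.2)} with hB
  obtain ⟨u, huB, hdisj, hcov⟩ :=
    Vitali.exists_disjoint_subfamily_covering_enlargement_closedBall B (fun p => p.1)
      (fun p => p.2) R (fun p hp => hR p.1 p.2 hp.1 hp.2) 5 (by norm_num)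
  have hcount : u.Countable := hdisj.countable_of_nonempty_interior fun p hp =>
    ⟨p.1, Metric.ball_subset_interior_closedBall (Metric.mem_ball_self (huB hp).1)⟩
  refine ⟨⋃ p ∈ u, Metric.closedBall p.1 (5 * p.2),
    MeasurableSet.biUnion hcount fun p _ => Metric.isClosed_closedBall.measurableSet, ?_, ?_⟩
  · intro y r hr hyr
    obtain ⟨q, hq, hsub⟩ := hcov (y, r) ⟨hr, hyr⟩
    exact hsub.trans (subset_biUnion_of_mem (u := fun p : Rd d × ℝ => Metric.closedBall p.1 (5 * p.2)) hq)
  · calc μ (⋃ p ∈ u, Metric.closedBall p.1 (5 * p.2))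
        ≤ ∑' p : u, μ (Metric.closedBall p.1.1 (5 * p.1.2)) := measure_biUnion_le μ hcount _
      _ ≤ ∑' p : u, ((c * 5 ^ n).toNNReal / ENNReal.ofReal t)
            * m (Metric.closedBall p.1.1 p.1.2) := by
          refine ENNReal.tsum_le_tsum fun p => ?_
          obtain ⟨h1, h2⟩ := huB p.2
          refine (hμ _ _ (by positivity)).trans ?_
          -- Each enlarged ball is paid for by the mass of the original one, and the original balls
          -- are disjoint.
          calc ENNReal.ofReal (c * (5 * p.1.2) ^ n)
              = ENNReal.ofReal (c * 5 ^ n / t) * ENNReal.ofReal (t * p.1.2 ^ n) := by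
                rw [← ENNReal.ofReal_mul (by positivity), mul_pow]
                congr 1; field_simp
            _ ≤ _ := by
                rw [ENNReal.ofReal_div_of_pos ht]
                gcongr
                rfl
      _ = ((c * 5 ^ n).toNNReal / ENNReal.ofReal t)
            * m (⋃ p ∈ u, Metric.closedBall p.1 p.2) := by
          rw [ENNReal.tsum_mul_left, measure_biUnion hcount hdisj
            fun p _ => Metric.isClosed_closedBall.measurableSet]
      _ ≤ _ := by gcongr; exact subset_univ _

/-! ### The stopping radius -/

section StopRadius

/-- The stopping radius: the largest depth of `y` inside a ball with `m(B) > t r^n`, and at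
least `τ`. -/
noncomputable def stopRadius (n : ℕ) (m : Measure (Rd d)) (t τ : ℝ) (y : Rd d) : ℝ :=
  sSup {s | s ≤ τ ∨ ∃ z r, 0 < r ∧ ENNReal.ofReal (t * r ^ n) < m (Metric.closedBall z r) ∧
    s + dist y z ≤ r}

variable {m : Measure (Rd d)} {t τ R : ℝ}

lemma stopRadius_le (hτ : τ ≤ R)
    (hR : ∀ y r, 0 < r → ENNReal.ofReal (t * r ^ n) < m (Metric.closedBall y r) → r ≤ R)
    (y : Rd d) : stopRadius n m t τ y ≤ R := by
  refine csSup_le ⟨τ, Or.inl le_rfl⟩ ?_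
  rintro s (hs | ⟨z, r, hr, hb, hs⟩)
  · exact hs.trans hτ
  · linarith [hR z r hr hb, dist_nonneg (x := y) (y := z)]

lemma le_stopRadius (hτ : τ ≤ R)
    (hR : ∀ y r, 0 < r → ENNReal.ofReal (t * r ^ n) < m (Metric.closedBall y r) → r ≤ R)
    {y : Rd d} {s : ℝ} (h : s ≤ τ ∨ ∃ z r, 0 < r ∧
      ENNReal.ofReal (t * r ^ n) < m (Metric.closedBall z r) ∧ s + dist y z ≤ r) :
    s ≤ stopRadius n m t τ y := by
  refine le_csSup ⟨R, ?_⟩ h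
  rintro s (hs | ⟨z, r, hr, hb, hs⟩)
  · exact hs.trans hτ
  · linarith [hR z r hr hb, dist_nonneg (x := y) (y := z)]

/-- Depth `s` at `y` inside a ball gives depth `s - dist y z` at `z`. The resulting 1-Lipschitz
bound makes the radius measurable and comparable at nearby points. -/
lemma stopRadius_le_add (hτ : τ ≤ R)
    (hR : ∀ y r, 0 < r → ENNReal.ofReal (t * r ^ n) < m (Metric.closedBall y r) → r ≤ R)
    (y z : Rd d) : stopRadius n m t τ y ≤ stopRadius n m t τ z + dist y z := by
  refine csSup_le ⟨τ, Or.inl le_rfl⟩ ?_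
  rintro s (hs | ⟨w, r, hr, hb, hs⟩)
  · linarith [le_stopRadius hτ hR (y := z) (s := s) (Or.inl hs), dist_nonneg (x := y) (y := z)]
  · have := dist_triangle z y w
    rw [dist_comm z y] at this
    linarith [le_stopRadius hτ hR (y := z) (s := s - dist y z)
      (Or.inr ⟨w, r, hr, hb, by linarith⟩)]

/-- A ball centred at `y` has depth equal to its radius there, so it cannot be heavy once its radius
exceeds the stopping radius. -/
lemma measure_closedBall_le_of_stopRadius_lt (hτ : τ ≤ R)
    (hR : ∀ y r, 0 < r → ENNReal.ofReal (t * r ^ n) < m (Metric.closedBall y r) → r ≤ R)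
    {y : Rd d} {s : ℝ} (hs : 0 < s) (h : stopRadius n m t τ y < s) :
    m (Metric.closedBall y s) ≤ ENNReal.ofReal (t * s ^ n) := by
  by_contra hb
  exact absurd (le_stopRadius hτ hR (y := y) (s := s)
    (Or.inr ⟨y, s, hs, not_le.1 hb, by simp⟩)) (not_le.2 h)

lemma of_lt_stopRadius {y : Rd d} {s : ℝ} (h : s < stopRadius n m t τ y) :
    s < τ ∨ ∃ z r, 0 < r ∧ ENNReal.ofReal (t * r ^ n) < m (Metric.closedBall z r) ∧
      s + dist y z ≤ r := by
  obtain ⟨s', hs', hlt⟩ := exists_lt_of_lt_csSup ⟨τ, Or.inl le_rfl⟩ h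
  rcases hs' with h1 | ⟨z, r, hr, hb, h1⟩
  · exact Or.inl (hlt.trans_le h1)
  · exact Or.inr ⟨z, r, hr, hb, by linarith⟩

end StopRadius

/-! ### Calderón–Zygmund decomposition on the boundary -/

/-- The weak type inequality for positive measures on `Γ`. -/
theorem exists_weak_of_support (hn : n ≠ 0) (hk : IsCZKernel n k) (hμ : HasGrowth n μ)
    (hT : BoundedL2 k σ μ) {Γ : Set (Rd d)} {a : ℝ} (ha : 0 < a)
    (hlow : ∀ x ∈ Γ, ∀ r : ℝ, 0 < r → ENNReal.ofReal r ≤ Metric.ediam Γ →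
      ENNReal.ofReal (a * r ^ n) ≤ σ (Metric.closedBall x r))
    (hfin : ∀ x r, σ (Metric.closedBall x r) < ∞) :
    ∃ c : ℝ≥0, ∀ (m : Measure (Rd d)) [IsFiniteMeasure m] (t ε : ℝ), m Γᶜ = 0 → 0 < t → 0 < ε →
      μ {x | t < ‖truncPos k ε m x‖} ≤ c / ENNReal.ofReal t * m univ := by
  have := sigmaFinite_of_closedBall hfin
  have := sigmaFinite_of_closedBall hμ.measure_closedBall_lt_top
  obtain ⟨c₁, h₁⟩ := hk.exists_weak_of_concentrated hμ hn
  obtain ⟨c₂, h₂⟩ := hμ.exists_cover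
  obtain ⟨A, hA⟩ := hk.exists_far hμ
  obtain ⟨C, hC⟩ := hT.exists_sq
  refine ⟨c₁ + (c₂ + 2 * A + 4 * (C * (22 ^ n / a).toNNReal)), fun m _ t ε hm ht hε => ?_⟩
  rcases eq_or_ne m 0 with rfl | hm0
  · simp [truncPos, ht.not_gt]
  have hM : 0 < m.real univ := by
    rw [measureReal_def]
    exact ENNReal.toReal_pos (by simpa using hm0) (measure_ne_top _ _)
  -- `t R^n` is the total mass, so no heavy ball has radius above `R`. If Γ has diameter at most
  -- `R`, the measure is concentrated; otherwise all stopping radii are at most `diam Γ` and lower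
  -- regularity is available.
  obtain ⟨R, hR0, hRn⟩ := exists_pow_eq hn (div_pos hM ht)
  rcases le_total (Metric.ediam Γ) (ENNReal.ofReal R) with hdiam | hdiam
  · obtain ⟨z, hz⟩ : Γ.Nonempty := by
      rw [nonempty_iff_ne_empty]
      rintro rfl
      simp at hm
      exact hm0 hm
    have hsub : Γ ⊆ Metric.closedBall z R := fun y hy => by
      rw [Metric.mem_closedBall, ← edist_le_ofReal hR0.le]
      exact (Metric.edist_le_ediam_of_mem hy hz).trans hdiam
    refine (h₁ m z R t ε hR0 ht hε (measure_mono_null (compl_subset_compl.2 hsub) hm) ?_).trans ?_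
    · rw [hRn]
      field_simp
      exact le_rfl
    · gcongr
      exact self_le_add_right _ _
  -- the stopping radii are bounded by `R`
  have hbad : ∀ y r, 0 < r → ENNReal.ofReal (t * r ^ n) < m (Metric.closedBall y r) → r ≤ R := by
    intro y r hr hb
    refine le_of_pow_le_pow_left₀ hn hR0.le ?_
    rw [hRn, le_div_iff₀ ht, mul_comm]
    have := (hb.trans_le (measure_mono (subset_univ _))).le
    rwa [← ofReal_measureReal, ENNReal.ofReal_le_ofReal_iff hM.le] at this
  -- The floor `τ` keeps the radii positive and is small enough that spreading at that scale is
  -- invisible to the truncation at `ε`.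
  set τ : ℝ := min (ε / 8) R with hτdef
  have hτ0 : 0 < τ := lt_min (by positivity) hR0
  have hτR : τ ≤ R := min_le_right _ _
  have hτε : τ ≤ ε / 8 := min_le_left _ _
  set ρ := stopRadius n m t τ with hρdef
  have hρτ : ∀ y, τ ≤ ρ y := fun y => le_stopRadius hτR hbad (Or.inl le_rfl)
  have hρR : ∀ y, ρ y ≤ R := stopRadius_le hτR hbad
  have hρlip : ∀ y z, ρ y ≤ ρ z + dist y z := stopRadius_le_add hτR hbad
  have hρm : Measurable fun y => ρ y / 10 :=
    (LipschitzWith.of_le_add hρlip).continuous.measurable.div_const 10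
  have hρ0 : ∀ y, 0 < ρ y := fun y => hτ0.trans_le (hρτ y)
  have hV : ∀ y ∈ Γ, ENNReal.ofReal (a * (ρ y / 10) ^ n) ≤ σ (Metric.closedBall y (ρ y / 10)) :=
    fun y hy => hlow y hy _ (by have := hρ0 y; positivity) <| le_trans
      (ENNReal.ofReal_le_ofReal (by linarith [hρR y, hρ0 y])) hdiam
  have hΓ : ∀ᵐ y ∂m, y ∈ Γ := by rwa [ae_iff]
  have hmem : ∀ y ∈ Γ, y ∈ smearSet σ fun y => ρ y / 10 := fun y hy =>
    ⟨(lt_of_lt_of_le (by have := hρ0 y; simp; positivity) (hV y hy)).ne', (hfin _ _).ne⟩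
  set κ := smearKernel σ hρm with hκ
  have hκm := smearKernel_comp hρm (hΓ.mono hmem)
  rw [← hκ] at hκm
  set f : Rd d → ℝ≥0∞ := fun z => ∫⁻ y, smearDensity σ (fun y => ρ y / 10) y z ∂m with hf
  have hfm : Measurable f :=
    ((measurable_smearDensity σ hρm).comp measurable_swap).lintegral_prod_right'
  -- If `z` lies within `ρ y / 10` of `y`, then `ρ y / 10 ≥ ρ z / 11` and `y` lies within `2 ρ z` of
  -- `z`. The ball of radius `2 ρ z` is not heavy, whence `(2 · 11)^n / a`.
  have hfle : ∀ z, f z ≤ ENNReal.ofReal (22 ^ n / a * t) := by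
    intro z
    have hz := hρ0 z
    calc f z ≤ ∫⁻ y, (Metric.closedBall z (2 * ρ z)).indicator
          (fun _ => (ENNReal.ofReal (a * (ρ z / 11) ^ n))⁻¹) y ∂m := by
          refine lintegral_mono_ae ?_
          filter_upwards [hΓ] with y hy
          by_cases hyz : z ∈ Metric.closedBall y (ρ y / 10)
          · have hd : dist z y ≤ ρ y / 10 := hyz
            have l1 := hρlip y z
            have l2 := hρlip z y
            rw [dist_comm] at l1
            rw [indicator_of_mem (by rw [Metric.mem_closedBall, dist_comm]; linarith)]
            refine (smearDensity_le y z).trans (ENNReal.inv_le_inv.2 (le_trans ?_ (hV y hy)))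
            refine ENNReal.ofReal_le_ofReal ?_
            gcongr ?_ * ?_ ^ n
            linarith
          · rw [smearDensity, indicator_of_notMem hyz]
            exact zero_le
      _ = (ENNReal.ofReal (a * (ρ z / 11) ^ n))⁻¹ * m (Metric.closedBall z (2 * ρ z)) := by
          rw [lintegral_indicator Metric.isClosed_closedBall.measurableSet, setLIntegral_const]
      _ ≤ (ENNReal.ofReal (a * (ρ z / 11) ^ n))⁻¹ * ENNReal.ofReal (t * (2 * ρ z) ^ n) := by
          gcongr
          exact measure_closedBall_le_of_stopRadius_lt hτR hbad (by positivity) (by linarith)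
      _ = ENNReal.ofReal (22 ^ n / a * t) := by
          rw [← ENNReal.ofReal_inv_of_pos (by positivity), ← ENNReal.ofReal_mul (by positivity)]
          congr 1
          rw [show (22 : ℝ) = 2 * 11 by norm_num, mul_pow, mul_pow, div_pow]
          field_simp
  have hmass : m.bind κ univ = m univ := by
    rw [Measure.bind_apply MeasurableSet.univ κ.aemeasurable]
    simp
  -- the good part
  have hgood : ∫⁻ x, ‖truncPos k ε (m.bind κ) x‖ₑ ^ 2 ∂μ
      ≤ C * ENNReal.ofReal (22 ^ n / a * t) * m univ := by
    rw [← hmass, hκm]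
    refine hC ε hε f hfm _ ENNReal.ofReal_ne_top hfle ?_
    rw [← hκm, hmass]
    exact measure_ne_top _ _
  -- the bad part, off the balls of large mass
  obtain ⟨E, hEm, hEsub, hE⟩ := h₂ m t R ht hbad
  have hbadpart : ∫⁻ x in Eᶜ, ‖truncPos k ε m x - truncPos k ε (m.bind κ) x‖ₑ ∂μ
      ≤ A * m univ := by
    refine hk.lintegral_truncPos_sub_bind_le hε (Filter.Eventually.of_forall fun y => ?_)
    refine hk.lintegral_truncKernel_sub_truncPos_le hε ?_
    have hy := hρ0 y
    filter_upwards [ae_smearKernel_mem_closedBall hρm (y := y) (by positivity)] with z hz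
    have hz' : ‖y - z‖ ≤ ρ y / 10 := by rwa [← dist_eq_norm, dist_comm]
    refine le_trans ?_ (hA ε (ρ y / 10) hε (by positivity) y z hz')
    rw [← lintegral_indicator hEm.compl, ← lintegral_indicator
      (isClosed_le continuous_const (by fun_prop : Continuous fun x : Rd d => ‖x - y‖)).measurableSet]
    refine lintegral_mono fun x => ?_
    by_cases hx : x ∈ E
    · simp [hx]
    rcases le_or_gt (2 * (ρ y / 10)) ‖x - y‖ with hxy | hxy
    · rw [indicator_of_mem (show x ∈ Eᶜ from hx), indicator_of_mem (by exact hxy)]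
    -- Otherwise `y` has depth `ρ y / 2` in a heavy ball, which then contains `x`, although `x ∉ E`.
    -- So `ρ y < 2τ ≤ ε/4`, and both truncated kernels vanish at `x`.
    have hnear : ρ y / 2 < τ := by
      rcases of_lt_stopRadius (show ρ y / 2 < stopRadius n m t τ y by rw [← hρdef]; linarith) with
        h | ⟨w, r, hr, hb, h⟩
      · exact h
      · refine absurd (hEsub w r hr hb ?_) hx
        rw [Metric.mem_closedBall]
        have := dist_triangle x y w
        rw [dist_eq_norm x y] at this
        linarith
    have hxz := norm_sub_le_norm_sub_add_norm_sub x y z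
    rw [indicator_of_mem (show x ∈ Eᶜ from hx), truncKernel_of_le (by linarith),
      truncKernel_of_le (by linarith)]
    simp
  have : IsFiniteMeasure (m.bind κ) := ⟨by rw [hmass]; exact measure_lt_top _ _⟩
  have hm1 := hk.measurable_truncPos hε m
  have hm2 := hk.measurable_truncPos hε (m.bind κ)
  have hsub : {x | t < ‖truncPos k ε m x‖} ⊆ E ∪
      ({x | t / 2 < ‖truncPos k ε m x - truncPos k ε (m.bind κ) x‖} ∩ Eᶜ
        ∪ {x | t / 2 < ‖truncPos k ε (m.bind κ) x‖}) := by
    intro x (hx : t < _)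
    by_cases hxE : x ∈ E
    · exact Or.inl hxE
    refine Or.inr ?_
    by_contra h
    simp only [mem_union, mem_inter_iff, mem_ofPred_eq, mem_compl_iff, hxE, not_false_eq_true,
      and_true, not_or, not_lt] at h
    have := norm_le_norm_sub_add (truncPos k ε m x) (truncPos k ε (m.bind κ) x)
    linarith
  have b1 : μ ({x | t / 2 < ‖truncPos k ε m x - truncPos k ε (m.bind κ) x‖} ∩ Eᶜ)
      ≤ A * m univ / ENNReal.ofReal (t / 2) := by
    rw [← Measure.restrict_apply' hEm.compl]
    refine (measure_lt_norm_le (hm1.sub hm2) (half_pos ht)).trans ?_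
    gcongr
    exact hbadpart
  have b2 := (measure_lt_norm_le_sq (μ := μ) hm2 (half_pos ht)).trans
    (ENNReal.div_le_div_right hgood _)
  refine (measure_mono hsub).trans ((measure_union_le _ _).trans
    ((add_le_add hE ((measure_union_le _ _).trans (add_le_add b1 b2))).trans ?_))
  have hT0 : ENNReal.ofReal t ≠ 0 := by simpa using ht
  have e : ENNReal.ofReal (22 ^ n / a * t)
      = ((22 ^ n / a).toNNReal : ℝ≥0∞) * ENNReal.ofReal t := ENNReal.ofReal_mul (by positivity)
  have hcancel : ENNReal.ofReal t * (ENNReal.ofReal t)⁻¹ = 1 :=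
    ENNReal.mul_inv_cancel hT0 ENNReal.ofReal_ne_top
  rw [e, ENNReal.div_eq_inv_mul, ENNReal.div_eq_inv_mul, ENNReal.div_eq_inv_mul,
    ENNReal.div_eq_inv_mul, ENNReal.inv_pow, inv_ofReal_half]
  push_cast
  generalize ((22 ^ n / a).toNNReal : ℝ≥0∞) = B
  calc _ = (ENNReal.ofReal t)⁻¹ * (c₂ + 2 * A
        + 4 * (C * B) * (ENNReal.ofReal t * (ENNReal.ofReal t)⁻¹)) * m univ := by ring
    _ ≤ _ := by
        rw [hcancel, mul_one]
        exact mul_le_mul' (mul_le_mul' le_rfl le_add_self) le_rfl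

/-! ### Position of `U` relative to its boundary -/

/-- The exterior of a ball is a continuous image of sphere times ray, and the sphere is connected in
dimension at least two. -/
lemma isPreconnected_compl_closedBall {E : Type*} [NormedAddCommGroup E] [NormedSpace ℝ E]
    (h : 1 < Module.rank ℝ E) (z : E) {R : ℝ} (hR : 0 ≤ R) :
    IsPreconnected (Metric.closedBall z R)ᶜ := by
  have himg : (Metric.closedBall z R)ᶜ
      = (fun p : E × ℝ => z + p.2 • p.1) '' (Metric.sphere 0 1 ×ˢ Ioi R) := by
    ext x
    simp only [mem_compl_iff, Metric.mem_closedBall, not_le, mem_image, mem_prod,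
      mem_sphere_zero_iff_norm, mem_Ioi, Prod.exists]
    constructor
    · intro hx
      rw [dist_eq_norm] at hx
      have hpos : 0 < ‖x - z‖ := hR.trans_lt hx
      refine ⟨‖x - z‖⁻¹ • (x - z), ‖x - z‖, ⟨?_, hx⟩, ?_⟩
      · rw [norm_smul, norm_inv, norm_norm, inv_mul_cancel₀ hpos.ne']
      · rw [smul_smul, mul_inv_cancel₀ hpos.ne', one_smul, add_sub_cancel]
    · rintro ⟨u, s, ⟨hu, hs⟩, rfl⟩
      rw [dist_eq_norm, add_sub_cancel_left, norm_smul, hu, mul_one,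
        Real.norm_of_nonneg (hR.trans hs.le)]
      exact hs
  rw [himg]
  exact ((isPreconnected_sphere h 0 1).prod isPreconnected_Ioi).image _
    (by fun_prop : Continuous fun p : E × ℝ => z + p.2 • p.1).continuousOn

/-- The exterior of the ball is connected and misses the boundary, so if it met `U` it would lie in
`U`, contradicting `y ∉ U`. -/
lemma closure_subset_closedBall {U : Set (Rd d)} (hrank : 1 < Module.rank ℝ (Rd d))
    (hU : IsOpen U) {y z : Rd d} {R : ℝ} (hR : 0 ≤ R) (hΓ : frontier U ⊆ Metric.closedBall z R)
    (hyU : y ∉ U) (hy : y ∉ Metric.closedBall z R) : closure U ⊆ Metric.closedBall z R := by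
  refine closure_minimal ?_ Metric.isClosed_closedBall
  intro u hu
  by_contra huz
  have hsub : (Metric.closedBall z R)ᶜ ⊆ U := by
    refine (isPreconnected_compl_closedBall hrank z hR).subset_left_of_subset_union hU
      isClosed_closure.isOpen_compl
      (disjoint_compl_right.mono_left subset_closure) ?_ ⟨u, huz, hu⟩
    intro x hx
    by_cases hxc : x ∈ closure U
    · left
      by_contra hxU
      exact hx (hΓ (by rw [hU.frontier_eq]; exact ⟨hxc, hxU⟩))
    · exact Or.inr hxc
  exact hyU (hsub hy)

/-- A point of the closure of `U` nearest to `y` lies on the frontier. -/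
lemma infDist_frontier_le {U : Set (Rd d)} (hne : U.Nonempty) {x y : Rd d} (hy : y ∉ U)
    (hx : x ∈ closure U) : Metric.infDist y (frontier U) ≤ dist y x := by
  obtain ⟨w, hw, hwd⟩ := exists_mem_frontier_infDist_compl_eq_dist (x := y) (s := Uᶜ) hy
    (by simpa using hne.ne_empty)
  rw [frontier_compl] at hw
  rw [compl_compl] at hwd
  calc Metric.infDist y (frontier U) ≤ dist y w := Metric.infDist_le_dist_of_mem hw
    _ = Metric.infDist y (closure U) := by rw [← hwd, Metric.infDist_closure]
    _ ≤ dist y x := Metric.infDist_le_dist_of_mem hx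

/-! ### Moving mass from the complement of `U` to the boundary -/

/-- A pointwise substitute for Cauchy–Schwarz, passing from an `L²` bound to an `L¹` bound on a
ball. -/
lemma le_add_inv_mul_sq {b β : ℝ≥0∞} (h0 : β ≠ 0) (h1 : β ≠ ∞) : b ≤ β + β⁻¹ * b ^ 2 := by
  rcases le_total b β with h | h
  · exact h.trans le_self_add
  · refine le_trans ?_ le_add_self
    calc b = β⁻¹ * (β * b) := by rw [← mul_assoc, ENNReal.inv_mul_cancel h0 h1, one_mul]
      _ ≤ β⁻¹ * b ^ 2 := by rw [sq]; gcongr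

/-- The `L¹` error of spreading a point mass off `U` onto the boundary of `U`. -/
lemma IsCZKernel.exists_smear_frontier (hk : IsCZKernel n k)
    (hμ : HasGrowth n μ) (hT : BoundedL2 k σ μ) {U : Set (Rd d)} (hne : U.Nonempty)
    {a : ℝ} (ha : 0 < a)
    (hlow : ∀ x ∈ frontier U, ∀ r : ℝ, 0 < r → ENNReal.ofReal r ≤ Metric.ediam (frontier U) →
      ENNReal.ofReal (a * r ^ n) ≤ σ (Metric.closedBall x r))
    (hfin : ∀ x r, σ (Metric.closedBall x r) < ∞) [SFinite σ]
    (hr : Measurable fun y => 2 * Metric.infDist y (frontier U)) :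
    ∃ A : ℝ≥0, ∀ (ε : ℝ) (y : Rd d), 0 < ε → y ∉ U → 0 < Metric.infDist y (frontier U) →
      ENNReal.ofReal (Metric.infDist y (frontier U)) ≤ Metric.ediam (frontier U) →
      y ∈ smearSet σ (fun y => 2 * Metric.infDist y (frontier U)) ∧
      ∫⁻ x in closure U, ‖truncKernel k ε x y - truncPos k ε (smearKernel σ hr y) x‖ₑ ∂μ ≤ A := by
  have := sigmaFinite_of_closedBall hμ.measure_closedBall_lt_top
  obtain ⟨c, hc, hsize⟩ := hk.exists_size
  obtain ⟨A, hA⟩ := hk.exists_far hμ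
  obtain ⟨C, hC⟩ := hT.exists_sq
  obtain ⟨c', hc', hμ⟩ := hμ
  refine ⟨A + ((c * (c' * 4 ^ n)).toNNReal + ((c' * 4 ^ n).toNNReal + C * (a⁻¹).toNNReal)),
    fun ε y hε hyU hδ hdiam => ?_⟩
  set δ := Metric.infDist y (frontier U) with hδdef
  have hΓ : (frontier U).Nonempty := by
    by_contra h
    rw [not_nonempty_iff_eq_empty] at h
    rw [hδdef, h, Metric.infDist_empty] at hδ
    exact lt_irrefl _ hδ
  obtain ⟨w, hw, hwd⟩ := isClosed_frontier.exists_infDist_eq_dist hΓ y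
  rw [← hδdef] at hwd
  -- The factor 2 in the radius ensures that the ball around `y` contains the ball of radius δ
  -- around the nearest boundary point `w`.
  have hV : ENNReal.ofReal (a * δ ^ n) ≤ σ (Metric.closedBall y (2 * δ)) :=
    (hlow w hw δ hδ hdiam).trans (measure_mono (Metric.closedBall_subset_closedBall'
      (by rw [dist_comm, ← hwd]; linarith)))
  have hpos : 0 < ENNReal.ofReal (a * δ ^ n) := by simp; positivity
  have hmem : y ∈ smearSet σ (fun y => 2 * Metric.infDist y (frontier U)) :=
    ⟨(hpos.trans_le hV).ne', (hfin _ _).ne⟩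
  refine ⟨hmem, ?_⟩
  set m := smearKernel σ hr y with hm
  have hms : Measurable fun x => truncKernel k ε x y := hk.measurable_truncKernel_left hε y
  have hmt : Measurable (truncPos k ε m) := hk.measurable_truncPos hε m
  have hμ4 : μ (Metric.closedBall y (4 * δ)) ≤ ENNReal.ofReal (c' * 4 ^ n * δ ^ n) := by
    refine (hμ y _ (by positivity)).trans_eq ?_
    rw [mul_pow, mul_assoc]
  have hcov : closure U ⊆ {x | 2 * (2 * δ) ≤ ‖x - y‖} ∪ (closure U ∩ Metric.closedBall y (4 * δ)) := by
    intro x hx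
    rcases le_total (2 * (2 * δ)) ‖x - y‖ with h | h
    · exact Or.inl h
    · refine Or.inr ⟨hx, ?_⟩
      rw [Metric.mem_closedBall, dist_eq_norm]
      linarith
  have hfar : ∫⁻ x in {x | 2 * (2 * δ) ≤ ‖x - y‖}, ‖truncKernel k ε x y - truncPos k ε m x‖ₑ ∂μ
      ≤ A := by
    refine hk.lintegral_truncKernel_sub_truncPos_le hε ?_
    filter_upwards [ae_smearKernel_mem_closedBall hr (σ := σ) (y := y)
      (by positivity)] with z hz
    exact hA ε (2 * δ) hε (by positivity) y z (by rwa [← dist_eq_norm, dist_comm])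
  have hδn : 0 < δ ^ n := by positivity
  have hnear1 : ∫⁻ x in closure U ∩ Metric.closedBall y (4 * δ), ‖truncKernel k ε x y‖ₑ ∂μ
      ≤ ENNReal.ofReal (c * (c' * 4 ^ n)) := by
    calc _ ≤ ∫⁻ _ in closure U ∩ Metric.closedBall y (4 * δ), ENNReal.ofReal (c / δ ^ n) ∂μ := by
          refine setLIntegral_mono' (isClosed_closure.inter Metric.isClosed_closedBall).measurableSet
            fun x hx => ?_
          rw [← ofReal_norm]
          refine ENNReal.ofReal_le_ofReal (hsize ε x y δ hδ fun _ => ?_)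
          rw [← dist_eq_norm, dist_comm]
          exact infDist_frontier_le hne hyU hx.1
      _ ≤ ENNReal.ofReal (c / δ ^ n) * ENNReal.ofReal (c' * 4 ^ n * δ ^ n) := by
          rw [setLIntegral_const]
          gcongr
          exact (measure_mono inter_subset_right).trans hμ4
      _ = _ := by
          rw [← ENNReal.ofReal_mul (by positivity)]
          congr 1; field_simp
  have hsq : ∫⁻ x, ‖truncPos k ε m x‖ₑ ^ 2 ∂μ ≤ C * (ENNReal.ofReal (a * δ ^ n))⁻¹ := by
    have huniv : m univ = 1 := measure_univ
    have hmd := smearKernel_of_mem (σ := σ) hr hmem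
    rw [← hm] at hmd
    rw [hmd] at huniv ⊢
    have := hC ε hε (smearDensity σ (fun y => 2 * Metric.infDist y (frontier U)) y)
      ((measurable_smearDensity σ hr).of_uncurry_left) (ENNReal.ofReal (a * δ ^ n))⁻¹
      (ENNReal.inv_ne_top.2 hpos.ne')
      (fun z => (smearDensity_le y z).trans (ENNReal.inv_le_inv.2 hV))
      (by rw [huniv]; exact ENNReal.one_ne_top)
    rwa [huniv, mul_one] at this
  have hnear2 : ∫⁻ x in closure U ∩ Metric.closedBall y (4 * δ), ‖truncPos k ε m x‖ₑ ∂μ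
      ≤ ENNReal.ofReal (c' * 4 ^ n) + C * ENNReal.ofReal a⁻¹ := by
    -- This weight balances the two terms: the ball has measure `O(δ^n)` and the squared `L²` norm
    -- is `O(δ^(-n))`.
    set β : ℝ≥0∞ := ENNReal.ofReal (δ ^ n)⁻¹ with hβ
    have hβi : β⁻¹ = ENNReal.ofReal (δ ^ n) := by
      rw [hβ, ENNReal.ofReal_inv_of_pos hδn, inv_inv]
    calc _ ≤ ∫⁻ x in Metric.closedBall y (4 * δ), ‖truncPos k ε m x‖ₑ ∂μ :=
          lintegral_mono_set inter_subset_right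
      _ ≤ ∫⁻ x in Metric.closedBall y (4 * δ), (β + β⁻¹ * ‖truncPos k ε m x‖ₑ ^ 2) ∂μ :=
          lintegral_mono fun x => le_add_inv_mul_sq (by simpa [hβ] using hδn) ENNReal.ofReal_ne_top
      _ ≤ β * ENNReal.ofReal (c' * 4 ^ n * δ ^ n)
            + β⁻¹ * (C * (ENNReal.ofReal (a * δ ^ n))⁻¹) := by
          rw [lintegral_add_left measurable_const, setLIntegral_const,
            lintegral_const_mul _ (hmt.enorm.pow_const 2)]
          gcongr
          exact (setLIntegral_le_lintegral _ _).trans hsq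
      _ = _ := by
          rw [hβi, hβ, ← ENNReal.ofReal_mul (by positivity),
            ← ENNReal.ofReal_inv_of_pos (by positivity),
            mul_left_comm (ENNReal.ofReal (δ ^ n)) (C : ℝ≥0∞),
            ← ENNReal.ofReal_mul (by positivity)]
          congr 2
          · field_simp
          · congr 1; field_simp
  calc _ ≤ ∫⁻ x in {x | 2 * (2 * δ) ≤ ‖x - y‖} ∪ (closure U ∩ Metric.closedBall y (4 * δ)),
          ‖truncKernel k ε x y - truncPos k ε m x‖ₑ ∂μ := lintegral_mono_set hcov
    _ ≤ _ + ∫⁻ x in closure U ∩ Metric.closedBall y (4 * δ),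
          (‖truncKernel k ε x y‖ₑ + ‖truncPos k ε m x‖ₑ) ∂μ :=
        (lintegral_union_le _ _ _).trans
          (add_le_add le_rfl (lintegral_mono fun x => enorm_sub_le))
    _ ≤ _ := by
        rw [lintegral_add_left hms.enorm]
        push_cast
        exact add_le_add hfar (add_le_add hnear1 hnear2)

/-- Point masses at a distance from `U` that exceeds the diameter of the boundary. -/
lemma IsCZKernel.exists_lintegral_of_far (hk : IsCZKernel n k) (hμ : HasGrowth n μ)
    (hrank : 1 < Module.rank ℝ (Rd d)) {U : Set (Rd d)} (hU : IsOpen U) (hne : U.Nonempty)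
    (hΓ : (frontier U).Nonempty) :
    ∃ A : ℝ≥0, ∀ (ε : ℝ) (y : Rd d), y ∉ U →
      Metric.ediam (frontier U) < ENNReal.ofReal (Metric.infDist y (frontier U)) →
      ∫⁻ x in closure U, ‖truncKernel k ε x y‖ₑ ∂μ ≤ A := by
  obtain ⟨c, hc, hsize⟩ := hk.exists_size
  obtain ⟨c', hc', hμ⟩ := hμ
  refine ⟨(c * c').toNNReal, fun ε y hyU hdiam => ?_⟩
  set δ := Metric.infDist y (frontier U) with hδdef
  have hδ : 0 < δ := by
    by_contra h
    rw [ENNReal.ofReal_of_nonpos (not_lt.1 h)] at hdiam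
    exact not_lt_zero hdiam
  obtain ⟨z, hz⟩ := hΓ
  have hD : (Metric.ediam (frontier U)).toReal < δ := by
    rw [← ENNReal.toReal_ofReal hδ.le]
    exact (ENNReal.toReal_lt_toReal hdiam.ne_top ENNReal.ofReal_ne_top).2 hdiam
  have hsub : frontier U ⊆ Metric.closedBall z (Metric.ediam (frontier U)).toReal := fun w hw => by
    rw [Metric.mem_closedBall, dist_edist]
    exact ENNReal.toReal_mono hdiam.ne_top (Metric.edist_le_ediam_of_mem hw hz)
  have hy : y ∉ Metric.closedBall z (Metric.ediam (frontier U)).toReal := by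
    rw [Metric.mem_closedBall, not_le]
    exact hD.trans_le (Metric.infDist_le_dist_of_mem hz)
  have hcl := closure_subset_closedBall hrank hU ENNReal.toReal_nonneg hsub hyU hy
  calc ∫⁻ x in closure U, ‖truncKernel k ε x y‖ₑ ∂μ
      ≤ ∫⁻ _ in closure U, ENNReal.ofReal (c / δ ^ n) ∂μ := by
        refine setLIntegral_mono' isClosed_closure.measurableSet fun x hx => ?_
        rw [← ofReal_norm]
        refine ENNReal.ofReal_le_ofReal (hsize ε x y δ hδ fun _ => ?_)
        rw [← dist_eq_norm, dist_comm]
        exact infDist_frontier_le hne hyU hx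
    _ ≤ ENNReal.ofReal (c / δ ^ n) * ENNReal.ofReal (c' * δ ^ n) := by
        rw [setLIntegral_const]
        gcongr
        exact (measure_mono (hcl.trans (Metric.closedBall_subset_closedBall hD.le))).trans
          (hμ z δ hδ)
    _ = _ := by
        rw [← ENNReal.ofReal_mul (by positivity), show c / δ ^ n * (c' * δ ^ n) = c * c' by
          field_simp]
        rfl

/-- The weak type inequality for positive measures off `U`. -/
theorem exists_weak_of_compl (hn : n ≠ 0) (hrank : 1 < Module.rank ℝ (Rd d))
    (hk : IsCZKernel n k) (hμ : HasGrowth n μ) (hT : BoundedL2 k σ μ)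
    {U : Set (Rd d)} (hU : IsOpen U) (hne : U.Nonempty) (hμU : μ (closure U)ᶜ = 0)
    {a : ℝ} (ha : 0 < a)
    (hlow : ∀ x ∈ frontier U, ∀ r : ℝ, 0 < r → ENNReal.ofReal r ≤ Metric.ediam (frontier U) →
      ENNReal.ofReal (a * r ^ n) ≤ σ (Metric.closedBall x r))
    (hfin : ∀ x r, σ (Metric.closedBall x r) < ∞) (hσ : σ (frontier U)ᶜ = 0) :
    ∃ c : ℝ≥0, ∀ (m : Measure (Rd d)) [IsFiniteMeasure m] (t ε : ℝ), m U = 0 → 0 < t → 0 < ε →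
      μ {x | t < ‖truncPos k ε m x‖} ≤ c / ENNReal.ofReal t * m univ := by
  have := sigmaFinite_of_closedBall hfin
  have := sigmaFinite_of_closedBall hμ.measure_closedBall_lt_top
  rcases (frontier U).eq_empty_or_nonempty with hemp | hΓ
  · have hUu : U = univ := (frontier_eq_empty_iff.1 hemp).resolve_left hne.ne_empty
    refine ⟨0, fun m _ t ε hm ht hε => ?_⟩
    rw [hUu, Measure.measure_univ_eq_zero] at hm
    simp [truncPos, hm, ht.not_gt]
  have hδm : Measurable fun y => Metric.infDist y (frontier U) :=
    (Metric.continuous_infDist_pt _).measurable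
  have hr : Measurable fun y => 2 * Metric.infDist y (frontier U) := hδm.const_mul 2
  obtain ⟨A₁, hA₁⟩ := hk.exists_lintegral_of_far hμ hrank hU hne hΓ
  obtain ⟨A₂, hA₂⟩ := hk.exists_smear_frontier hμ hT hne ha hlow hfin hr
  obtain ⟨c, hc⟩ := exists_weak_of_support hn hk hμ hT ha hlow hfin
  refine ⟨2 * (A₁ + A₂) + 2 * c, fun m _ t ε hm ht hε => ?_⟩
  -- At these points regularity is not available at the scale δ, so their mass is not spread; its
  -- contribution is bounded directly and left out of `m'`.
  set S : Set (Rd d) :=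
    {y | Metric.ediam (frontier U) < ENNReal.ofReal (Metric.infDist y (frontier U))} with hS
  have hSm : MeasurableSet S := measurableSet_lt measurable_const hδm.ennreal_ofReal
  have hmU : ∀ᵐ y ∂m, y ∉ U := by simpa [ae_iff] using hm
  set κ := smearKernel σ hr with hκ
  set m' : Measure (Rd d) := (m.restrict Sᶜ).bind κ with hm'
  -- On the boundary the spreading radius is zero, so the mass stays in place.
  have hcaseΓ : ∀ y, Metric.infDist y (frontier U) = 0 → y ∈ frontier U ∧ ∀ᵐ z ∂κ y, z = y := by
    intro y hy
    refine ⟨(isClosed_frontier.mem_iff_infDist_zero hΓ).2 hy, ?_⟩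
    filter_upwards [ae_smearKernel_mem_closedBall hr (σ := σ) (y := y) (by rw [hy]; simp)] with z hz
    simpa [hy] using hz
  have hpt : ∀ᵐ y ∂(m.restrict Sᶜ),
      ∫⁻ x in closure U, ‖truncKernel k ε x y - truncPos k ε (κ y) x‖ₑ ∂μ ≤ A₂ := by
    filter_upwards [ae_restrict_mem hSm.compl, ae_restrict_of_ae hmU] with y hyS hyU
    rcases Metric.infDist_nonneg.eq_or_lt' (a := Metric.infDist y (frontier U)) with h0 | h0
    · refine hk.lintegral_truncKernel_sub_truncPos_le hε ?_
      filter_upwards [(hcaseΓ y h0).2] with z hz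
      simp [hz]
    · exact (hA₂ ε y hε hyU h0 (not_lt.1 hyS)).2
  have hsupp : m' (frontier U)ᶜ = 0 := by
    rw [hm', Measure.bind_apply isClosed_frontier.isOpen_compl.measurableSet κ.aemeasurable]
    rw [lintegral_eq_zero_iff (κ.measurable_coe isClosed_frontier.isOpen_compl.measurableSet)]
    filter_upwards [ae_restrict_mem hSm.compl, ae_restrict_of_ae hmU] with y hyS hyU
    rcases Metric.infDist_nonneg.eq_or_lt' (a := Metric.infDist y (frontier U)) with h0 | h0
    · obtain ⟨h1, h2⟩ := hcaseΓ y h0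
      have : ∀ᵐ z ∂κ y, z ∈ frontier U := by
        filter_upwards [h2] with z hz
        rwa [hz]
      rwa [ae_iff] at this
    · rw [hκ, smearKernel_of_mem hr (hA₂ ε y hε hyU h0 (not_lt.1 hyS)).1]
      exact withDensity_absolutelyContinuous _ _ hσ
  have hmass : m' univ ≤ m univ := by
    rw [hm', Measure.bind_apply MeasurableSet.univ κ.aemeasurable]
    simp only [measure_univ, lintegral_const, one_mul]
    exact Measure.restrict_apply_le _ _
  have : IsFiniteMeasure m' := ⟨hmass.trans_lt (measure_lt_top _ _)⟩
  have hfar : ∫⁻ x in closure U, ‖truncPos k ε (m.restrict S) x‖ₑ ∂μ ≤ A₁ * m univ := by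
    calc _ ≤ ∫⁻ x in closure U, ∫⁻ y in S, ‖truncKernel k ε x y‖ₑ ∂m ∂μ :=
          lintegral_mono fun x => enorm_integral_le_lintegral_enorm _
      _ = ∫⁻ y in S, ∫⁻ x in closure U, ‖truncKernel k ε x y‖ₑ ∂μ ∂m :=
          lintegral_lintegral_swap (hk.measurable_truncKernel hε).enorm.aemeasurable
      _ ≤ ∫⁻ _ in S, A₁ ∂m := by
          refine lintegral_mono_ae ?_
          filter_upwards [ae_restrict_mem hSm, ae_restrict_of_ae hmU] with y hyS hyU
          exact hA₁ ε y hyU hyS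
      _ ≤ _ := by
          rw [setLIntegral_const]
          gcongr
          exact subset_univ _
  have hnear := hk.lintegral_truncPos_sub_bind_le hε hpt
  rw [← hm'] at hnear
  have hm0 := hk.measurable_truncPos hε m
  have hmS := hk.measurable_truncPos hε (m.restrict S)
  have hmS' := hk.measurable_truncPos hε (m.restrict Sᶜ)
  have hmm' := hk.measurable_truncPos hε m'
  have hdiff : ∫⁻ x in closure U, ‖truncPos k ε m x - truncPos k ε m' x‖ₑ ∂μ
      ≤ (A₁ + A₂) * m univ := by
    calc _ ≤ ∫⁻ x in closure U, (‖truncPos k ε (m.restrict S) x‖ₑ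
          + ‖truncPos k ε (m.restrict Sᶜ) x - truncPos k ε m' x‖ₑ) ∂μ := by
          refine lintegral_mono fun x => ?_
          have : truncPos k ε m x
              = truncPos k ε (m.restrict S) x + truncPos k ε (m.restrict Sᶜ) x :=
            (integral_add_compl hSm (hk.integrable_truncKernel hε x m)).symm
          rw [this, add_sub_assoc]
          exact enorm_add_le _ _
      _ ≤ A₁ * m univ + A₂ * m univ := by
          rw [lintegral_add_left hmS.enorm]
          refine add_le_add hfar (hnear.trans ?_)
          gcongr
          exact Measure.restrict_le_self
      _ = _ := (add_mul _ _ _).symm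
  have hsub : {x | t < ‖truncPos k ε m x‖} ⊆ (closure U)ᶜ ∪
      ({x | t / 2 < ‖truncPos k ε m x - truncPos k ε m' x‖} ∩ closure U
        ∪ {x | t / 2 < ‖truncPos k ε m' x‖}) := by
    intro x (hx : t < _)
    by_cases hxE : x ∈ closure U
    · refine Or.inr ?_
      by_contra h
      simp only [mem_union, mem_inter_iff, mem_ofPred_eq, hxE, and_true, not_or, not_lt] at h
      have := norm_le_norm_sub_add (truncPos k ε m x) (truncPos k ε m' x)
      linarith
    · exact Or.inl hxE
  have b1 : μ ({x | t / 2 < ‖truncPos k ε m x - truncPos k ε m' x‖} ∩ closure U)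
      ≤ (A₁ + A₂) * m univ / ENNReal.ofReal (t / 2) := by
    rw [← Measure.restrict_apply' isClosed_closure.measurableSet]
    refine (measure_lt_norm_le (hm0.sub hmm') (half_pos ht)).trans ?_
    gcongr
    exact hdiff
  have b2 : μ {x | t / 2 < ‖truncPos k ε m' x‖} ≤ c / ENNReal.ofReal (t / 2) * m univ :=
    (hc m' (t / 2) ε hsupp (half_pos ht) hε).trans (by gcongr)
  refine (measure_mono hsub).trans ((measure_union_le _ _).trans
    ((add_le_add hμU.le ((measure_union_le _ _).trans (add_le_add b1 b2))).trans_eq ?_))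
  rw [ENNReal.div_eq_inv_mul, ENNReal.div_eq_inv_mul, ENNReal.div_eq_inv_mul, inv_ofReal_half]
  push_cast
  ring

/-! ### Dimension zero, complex measures, and the conclusion -/

/-- In dimension zero the weak type inequality is trivial. -/
lemma exists_weak_of_dim_zero (hk : IsCZKernel 0 k) (hμ : HasGrowth 0 μ) :
    ∃ c : ℝ≥0, ∀ (m : Measure (Rd d)) [IsFiniteMeasure m] (t ε : ℝ), 0 < t → 0 < ε →
      μ {x | t < ‖truncPos k ε m x‖} ≤ c / ENNReal.ofReal t * m univ := by
  obtain ⟨c, hc, hsize⟩ := hk.exists_size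
  obtain ⟨c', hc', hμ⟩ := hμ
  have hμu : μ univ ≤ ENNReal.ofReal c' := by
    rw [← Metric.iUnion_closedBall_nat (0 : Rd d), Monotone.measure_iUnion
      fun i j hij => Metric.closedBall_subset_closedBall (Nat.cast_le.2 hij)]
    refine iSup_le fun i => ?_
    refine (measure_mono (Metric.closedBall_subset_closedBall
      (by linarith : (i : ℝ) ≤ i + 1))).trans ((hμ 0 (i + 1) (by positivity)).trans_eq (by simp))
  refine ⟨(c' * c).toNNReal, fun m _ t ε ht hε => ?_⟩
  -- Below this level the finite total mass of `μ` is enough; above it the level set is empty.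
  rcases lt_or_ge t (c * m.real univ) with h | h
  · calc μ {x | t < ‖truncPos k ε m x‖} ≤ ENNReal.ofReal c' :=
          (measure_mono (subset_univ _)).trans hμu
      _ ≤ ENNReal.ofReal (c' * c / t * m.real univ) := by
          refine ENNReal.ofReal_le_ofReal ?_
          rw [div_mul_eq_mul_div, le_div_iff₀ ht, mul_assoc]
          gcongr
      _ = _ := by
          rw [ENNReal.ofReal_mul (by positivity), ENNReal.ofReal_div_of_pos ht, ofReal_measureReal]
          rfl
  · have : {x | t < ‖truncPos k ε m x‖} = ∅ := by
      refine eq_empty_of_forall_notMem fun x (hx : t < _) => ?_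
      have hb : ∀ᵐ y ∂m, ‖truncKernel k ε x y‖ ≤ c := Filter.Eventually.of_forall fun y => by
        simpa using hsize ε x y ε hε le_of_lt
      exact absurd hx (not_lt.2 ((norm_integral_le_of_norm_le_const hb).trans h))
    rw [this, measure_empty]
    exact zero_le

/-- The weak type inequality for complex measures follows from that for positive measures. -/
lemma boundedWeakL1_of_pos (hk : IsCZKernel n k) {U : Set (Rd d)} (hU : MeasurableSet U)
    (h : ∃ c : ℝ≥0, ∀ (m : Measure (Rd d)) [IsFiniteMeasure m] (t ε : ℝ), m U = 0 → 0 < t →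
      0 < ε → μ {x | t < ‖truncPos k ε m x‖} ≤ c / ENNReal.ofReal t * m univ) :
    BoundedWeakL1 k Uᶜ μ := by
  obtain ⟨c, hc⟩ := h
  -- Four positive measures, each at level `t/4`.
  refine ⟨16 * c, fun ν hν t ht ε hε => ?_⟩
  rw [compl_compl] at hν
  obtain ⟨p, hpfin, hple, hp⟩ := exists_jordan ν
  have hsub : {x | t < ‖truncMeas k ε ν x‖}
      ⊆ ⋃ i : Fin 4, {x | t / 2 / 2 < ‖truncPos k ε (p i) x‖} := by
    intro x (hx : t < _)
    rw [truncMeas_eq, hp _ fun i => hk.integrable_truncKernel hε x (p i)] at hx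
    by_contra hcon
    simp only [mem_iUnion, mem_ofPred_eq, not_exists, not_lt] at hcon
    refine absurd hx (not_lt.2 ?_)
    change ‖truncPos k ε (p 0) x - truncPos k ε (p 1) x
      + Complex.I * (truncPos k ε (p 2) x - truncPos k ε (p 3) x)‖ ≤ t
    refine (norm_add_le _ _).trans ?_
    rw [norm_mul, Complex.norm_I, one_mul]
    linarith [norm_sub_le (truncPos k ε (p 0) x) (truncPos k ε (p 1) x),
      norm_sub_le (truncPos k ε (p 2) x) (truncPos k ε (p 3) x), hcon 0, hcon 1, hcon 2, hcon 3]
  have huniv : ν.variation univ ≤ ν.variation Uᶜ := by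
    rw [← measure_add_measure_compl hU, hν, zero_add]
  calc μ {x | t < ‖truncMeas k ε ν x‖}
      ≤ ∑ i : Fin 4, μ {x | t / 2 / 2 < ‖truncPos k ε (p i) x‖} :=
        (measure_mono hsub).trans (measure_iUnion_fintype_le _ _)
    _ ≤ ∑ _i : Fin 4, c / ENNReal.ofReal (t / 2 / 2) * ν.variation Uᶜ := by
        refine Finset.sum_le_sum fun i _ => ?_
        have := hpfin i
        exact (hc (p i) (t / 2 / 2) ε (le_antisymm ((hple i U).trans hν.le) zero_le)
          (by positivity) hε).trans (mul_le_mul' le_rfl ((hple i univ).trans huniv))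
    _ = _ := by
        rw [Finset.sum_const, Finset.card_univ, Fintype.card_fin, ENNReal.div_eq_inv_mul,
          inv_ofReal_half, inv_ofReal_half, ENNReal.div_eq_inv_mul]
        push_cast
        ring

/-- Regularity only covers centres in `E` and radii up to the diameter. A larger ball contains no
more of `E` than the ball whose radius is the diameter; if the diameter is zero, `E` has at most one
point, which is null because `n ≠ 0`. Other centres are moved into `E` by enlarging the ball. -/
lemma IsADRegularSet.measure_closedBall_lt_top {E : Set (Rd d)} (hE : IsADRegularSet n E)
    (hn : n ≠ 0) (x : Rd d) (r : ℝ) : hausdorffOn n E (Metric.closedBall x r) < ∞ := by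
  obtain ⟨c, -, hc⟩ := hE
  have key : ∀ w ∈ E, ∀ s : ℝ, 0 < s → hausdorffOn n E (Metric.closedBall w s) < ∞ := by
    intro w hw s hs
    rcases le_or_gt (ENNReal.ofReal s) (Metric.ediam E) with h | h
    · exact (hc w hw s hs h).2.trans_lt ENNReal.ofReal_lt_top
    rw [hausdorffOn, Measure.restrict_apply Metric.isClosed_closedBall.measurableSet]
    rcases eq_or_ne (Metric.ediam E) 0 with h0 | h0
    · have : NullSingletonClass (Measure.hausdorffMeasure (n : ℝ) : Measure (Rd d)) :=
        Measure.nullSingletonClass_hausdorff (Rd d) (by positivity)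
      rw [((Metric.ediam_eq_zero_iff.1 h0).anti inter_subset_right).measure_zero]
      exact ENNReal.zero_lt_top
    · have hD := (hc w hw _ (ENNReal.toReal_pos h0 h.ne_top) ENNReal.ofReal_toReal_le).2
      rw [hausdorffOn, Measure.restrict_apply Metric.isClosed_closedBall.measurableSet] at hD
      refine (measure_mono ?_).trans_lt (hD.trans_lt ENNReal.ofReal_lt_top)
      refine fun y hy => ⟨?_, hy.2⟩
      rw [Metric.mem_closedBall, dist_edist]
      exact ENNReal.toReal_mono h.ne_top (Metric.edist_le_ediam_of_mem hy.2 hw)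
  rcases (Metric.closedBall x r ∩ E).eq_empty_or_nonempty with h | ⟨w, hwx, hwE⟩
  · rw [hausdorffOn, Measure.restrict_apply Metric.isClosed_closedBall.measurableSet, h,
      measure_empty]
    exact ENNReal.zero_lt_top
  · have hr : 0 ≤ r := dist_nonneg.trans hwx
    refine (measure_mono (Metric.closedBall_subset_closedBall' ?_)).trans_lt
      (key w hwE (2 * r + 1) (by positivity))
    rw [Metric.mem_closedBall, dist_comm] at hwx
    linarith

end CZ

theorem theorem3p1 (d : ℕ) (hd : 1 ≤ d) (U : Set (CZ.Rd d)) (hUo : IsOpen U)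
    (hUc : IsConnected U) (hΓ : CZ.IsADRegularSet (d - 1) (frontier U))
    (μ : MeasureTheory.Measure (CZ.Rd d)) (hμ : CZ.HasGrowth (d - 1) μ)
    (hμU : μ (closure U)ᶜ = 0)
    (k : CZ.Rd d → CZ.Rd d → ℂ) (hk : CZ.IsCZKernel (d - 1) k)
    (hT : CZ.BoundedL2 k (CZ.hausdorffOn (d - 1) (frontier U)) μ) :
    CZ.BoundedWeakL1 k Uᶜ μ := by
  refine CZ.boundedWeakL1_of_pos hk hUo.measurableSet ?_
  -- `d = 1` is separate: the argument takes `n`-th roots and uses that the exterior of a ball is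
  -- connected.
  rcases eq_or_ne (d - 1) 0 with h0 | hn
  · rw [h0] at hk hμ
    obtain ⟨c, hc⟩ := CZ.exists_weak_of_dim_zero hk hμ
    exact ⟨c, fun m _ t ε _ ht hε => hc m t ε ht hε⟩
  · have hrank : 1 < Module.rank ℝ (CZ.Rd d) := by
      rw [← Module.finrank_eq_rank, finrank_euclideanSpace_fin]
      exact_mod_cast (by omega : 1 < d)
    have hfin := hΓ.measure_closedBall_lt_top hn
    obtain ⟨c, hc, hreg⟩ := hΓ
    refine CZ.exists_weak_of_compl hn hrank hk hμ hT hUo hUc.nonempty hμU (inv_pos.2 hc)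
      (fun x hx r hr hrd => (hreg x hx r hr hrd).1) hfin ?_
    rw [CZ.hausdorffOn, MeasureTheory.Measure.restrict_apply
      isClosed_frontier.isOpen_compl.measurableSet, compl_inter_self, MeasureTheory.measure_empty]
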